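/- Let $\mathcal H$ be a complex Hilbert space, let $A\ge 1$ be a self-adjoint operator on $\mathcal H$ with quadratic form domain $Q(A)$ and dual $Q(A)^*$ ($Q(A)\subset\mathcal H\subset Q(A)^*$), and let $\{H(t)\}_{t\in[0,1)}$ be a family of symmetric (Hermitian sesquilinear) forms on $Q(A)$. Let $C>0$ and assume the following. (a) There is a self-adjoint operator $B\ge 0$ which commutes with $A$ (i.e. their resolvents commute), whose form domain satisfies $Q(A)\subset Q(B)$, and such that for all $t\in[0,1)$ $$C^{-1}A-CB\le H(t)\le CA,\qquad i[H(t),B]\le CA .$$ The first inequalities are inequalities of quadratic forms on $Q(A)$. The second one means $$i\big(\langle x,H(t)Bx\rangle-\langle Bx,H(t)x\rangle\big)\le C\langle x,Ax\rangle$$ for all $x\in Q(A)\cap D(B)$ with $Bx\in Q(A)$. (b) For every $x\in Q(A)$ the function $t\mapsto\langle x,H(t)x\rangle$ is differentiable on $[0,1)$ (from the right at $t=0$) and $$-C\langle x,Ax\rangle\le\frac{d}{dt}\langle x,H(t)x\rangle\le C\langle x,Ax\rangle .$$ Then for every $x_0\in Q(A)$ there is a unique $x\in L^\infty(0,1;Q(A))$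 such that $t\mapsto x(t)$ is continuous from $[0,1)$ to $\mathcal H$, $x(0)=x_0$, and $$i\dot x(t)=H(t)x(t)\quad\text{in } Q(A)^* ,$$ where the time derivative is taken in the sense of $Q(A)^*$-valued distributions on $(0,1)$. Moreover, for all $t\in[0,1)$ we have $\|x(t)\|=\|x_0\|$, $x(t)\in Q(A)$ and $$\langle x(t),Ax(t)\rangle\le Ke^{Kt}\big(\langle x_0,Ax_0\rangle+K\big),$$ where the constant $K>0$ depends only on $C$ and on the relative form bound $\beta=\sup\{\langle x,Bx\rangle: x\in Q(A),\ \langle x,Ax\rangle\le 1\}$ (which is finite because $Q(A)\subset Q(B)$). -/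

import Mathlib

open Filter Topology MeasureTheory Set
open scoped ComplexConjugate ContDiff

/-- A (possibly unbounded) positive self-adjoint operator on a complex Hilbert space. -/
structure PosSelfAdjoint (E : Type*) [NormedAddCommGroup E] [InnerProductSpace ℂ E]
    [CompleteSpace E] where
  /-- the underlying partially defined operator -/
  op : E →ₗ.[ℂ] E
  isSelfAdjoint : IsSelfAdjoint op
  nonneg : ∀ x : op.domain, 0 ≤ (inner ℂ (x : E) (op x)).re

namespace PosSelfAdjoint

variable {E : Type*} [NormedAddCommGroup E] [InnerProductSpace ℂ E] [CompleteSpace E]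

/-- The expectation value `⟨x, T x⟩` for `x` in the operator domain. -/
noncomputable def energy (T : PosSelfAdjoint E) (x : T.op.domain) : ℝ :=
  (inner ℂ (x : E) (T.op x)).re

/-- `u` is a sequence in the operator domain which converges to `x` in the Hilbert space and is
Cauchy for the form norm of `T`. -/
def IsFormApprox (T : PosSelfAdjoint E) (x : E) (u : ℕ → T.op.domain) : Prop :=
  Tendsto (fun n => (u n : E)) atTop (𝓝 x) ∧
    Tendsto (fun p : ℕ × ℕ => T.energy (u p.1 - u p.2)) atTop (𝓝 0)

theorem energy_add_le (T : PosSelfAdjoint E) (x y : T.op.domain) :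
    T.energy (x + y) ≤ 2 * T.energy x + 2 * T.energy y := by
  have h := T.nonneg (x - y)
  simp only [energy, LinearPMap.map_add, LinearPMap.map_sub, Submodule.coe_add, Submodule.coe_sub,
    inner_add_left, inner_add_right, inner_sub_left, inner_sub_right, Complex.add_re,
    Complex.sub_re] at h ⊢
  linarith

theorem energy_smul (T : PosSelfAdjoint E) (c : ℂ) (x : T.op.domain) :
    T.energy (c • x) = ‖c‖ ^ 2 * T.energy x := by
  simp only [energy, LinearPMap.map_smul, Submodule.coe_smul, inner_smul_left, inner_smul_right]
  rw [← mul_assoc, Complex.mul_conj, Complex.re_ofReal_mul, Complex.normSq_eq_norm_sq]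

/-- The quadratic form domain `Q(T)`: the completion of the operator domain in the form norm,
realised inside the Hilbert space. -/
def formDomain (T : PosSelfAdjoint E) : Submodule ℂ E where
  carrier := {x | ∃ u, T.IsFormApprox x u}
  zero_mem' := ⟨fun _ => 0, by simp [IsFormApprox, energy]⟩
  add_mem' := by
    rintro x y ⟨u, hu, hu'⟩ ⟨v, hv, hv'⟩
    refine ⟨fun n => u n + v n, by simpa using hu.add hv, ?_⟩
    refine squeeze_zero (fun _ => T.nonneg _) (fun p => ?_)
      (by simpa using (hu'.const_mul 2).add (hv'.const_mul 2))
    have := T.energy_add_le (u p.1 - u p.2) (v p.1 - v p.2)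
    rwa [← add_sub_add_comm] at this
  smul_mem' := by
    rintro c x ⟨u, hu, hu'⟩
    refine ⟨fun n => c • u n, by simpa using hu.const_smul c, ?_⟩
    simp only [← smul_sub, energy_smul]
    simpa using hu'.const_mul (‖c‖ ^ 2)

/-- The closed quadratic form `x ↦ ⟨x, T x⟩` on `Q(T)`: the limit of `⟨uₙ, T uₙ⟩` along
approximating sequences (see `tendsto_form` for the independence of the sequence). -/
noncomputable def form (T : PosSelfAdjoint E) (x : T.formDomain) : ℝ :=
  limUnder atTop fun n => T.energy (Classical.choose x.2 n)

theorem inner_symm' (T : PosSelfAdjoint E) (x y : T.op.domain) :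
    (inner ℂ (x : E) (T.op y)).re = (inner ℂ (y : E) (T.op x)).re := by
  have h := LinearPMap.adjoint_isFormalAdjoint (T := T.op) T.isSelfAdjoint.dense_domain
  rw [LinearPMap.isSelfAdjoint_def.mp T.isSelfAdjoint] at h
  rw [← h x y, ← inner_conj_symm, Complex.conj_re]

theorem sqrt_energy_add_le (T : PosSelfAdjoint E) (x y : T.op.domain) :
    √(T.energy (x + y)) ≤ √(T.energy x) + √(T.energy y) := by
  have hx : 0 ≤ T.energy x := T.nonneg x
  have hy : 0 ≤ T.energy y := T.nonneg y
  set c := (inner ℂ (x : E) (T.op y)).re with hc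
  have key : ∀ s : ℝ, T.energy (x + (s : ℂ) • y) =
      T.energy y * (s * s) + 2 * c * s + T.energy x := by
    intro s
    have h := T.inner_symm' x y
    simp only [energy, LinearPMap.map_add, LinearPMap.map_smul, Submodule.coe_add,
      Submodule.coe_smul, inner_add_left, inner_add_right, inner_smul_left, inner_smul_right,
      Complex.add_re, Complex.conj_ofReal, Complex.re_ofReal_mul, ← h]
    ring
  have hd := discrim_le_zero (a := T.energy y) (b := 2 * c) (c := T.energy x)
    (fun s => by rw [← key]; exact T.nonneg _)
  have h1 := key 1
  simp only [Complex.ofReal_one, one_smul] at h1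
  have hcs : c ≤ √(T.energy x) * √(T.energy y) := by
    rw [← Real.sqrt_mul hx]
    refine Real.le_sqrt_of_sq_le ?_
    unfold discrim at hd
    linarith
  rw [Real.sqrt_le_iff]
  refine ⟨by positivity, ?_⟩
  rw [h1, add_sq, Real.sq_sqrt hx, Real.sq_sqrt hy]
  linarith

theorem abs_sqrt_energy_sub_le (T : PosSelfAdjoint E) (x y : T.op.domain) :
    |√(T.energy x) - √(T.energy y)| ≤ √(T.energy (x - y)) := by
  have h1 := T.sqrt_energy_add_le (x - y) y
  have h2 := T.sqrt_energy_add_le (y - x) x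
  have h3 : T.energy (y - x) = T.energy (x - y) := by
    have := T.energy_smul (-1) (x - y)
    simpa using this
  rw [sub_add_cancel] at h1 h2
  rw [h3] at h2
  rw [abs_le]
  constructor <;> linarith

theorem tendsto_energy_zero (T : PosSelfAdjoint E) {w : ℕ → T.op.domain}
    (hw : T.IsFormApprox 0 w) : Tendsto (fun n => T.energy (w n)) atTop (𝓝 0) := by
  rw [Metric.tendsto_atTop]
  intro ε hε
  obtain ⟨N, hN⟩ := Metric.tendsto_atTop.mp hw.2 (ε / 2) (half_pos hε)
  refine ⟨max N.1 N.2, fun m hm => ?_⟩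
  have hm1 : N.1 ≤ m := (le_max_left _ _).trans hm
  have hm2 : N.2 ≤ m := (le_max_right _ _).trans hm
  have hlim : Tendsto (fun n => ε / 2 + 2 * (inner ℂ (w n : E) (T.op (w m))).re) atTop
      (𝓝 (ε / 2)) := by
    have h := (Complex.continuous_re.tendsto _).comp
      (hw.1.inner (𝕜 := ℂ) (tendsto_const_nhds (x := T.op (w m))))
    simp only [inner_zero_left, Complex.zero_re] at h
    simpa using (h.const_mul 2).const_add (ε / 2)
  have hle : T.energy (w m) ≤ ε / 2 := by
    refine ge_of_tendsto hlim ?_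
    filter_upwards [eventually_ge_atTop N.1] with n hn
    have h1 := hN (n, m) ⟨hn, hm2⟩
    have h2 := T.inner_symm' (w n) (w m)
    have h3 := T.nonneg (w n)
    rw [Real.dist_0_eq_abs] at h1
    have h4 := (abs_lt.mp h1).2
    simp only [energy, LinearPMap.map_sub, Submodule.coe_sub, inner_sub_left, inner_sub_right,
      Complex.sub_re] at h4 ⊢
    linarith
  have h0 : 0 ≤ T.energy (w m) := T.nonneg _
  rw [Real.dist_0_eq_abs, abs_of_nonneg h0]
  linarith

/-- The value of the form is the limit of the energies along every approximating sequence. -/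
theorem tendsto_form (T : PosSelfAdjoint E) (x : T.formDomain) {u : ℕ → T.op.domain}
    (hu : T.IsFormApprox x u) : Tendsto (fun n => T.energy (u n)) atTop (𝓝 (T.form x)) := by
  have hv := Classical.choose_spec x.2
  set v := Classical.choose x.2 with hvdef
  have hcauchy : CauchySeq fun n => √(T.energy (v n)) := by
    rw [cauchySeq_iff_tendsto_dist_atTop_0]
    refine squeeze_zero (fun _ => dist_nonneg) (fun p => ?_)
      (by simpa using (Real.continuous_sqrt.tendsto 0).comp hv.2)
    exact T.abs_sqrt_energy_sub_le _ _
  obtain ⟨l, hl⟩ := cauchySeq_tendsto_of_complete hcauchy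
  have hsq : ∀ y : T.op.domain, √(T.energy y) ^ 2 = T.energy y :=
    fun y => Real.sq_sqrt (T.nonneg y)
  have hform : T.form x = l ^ 2 := by
    refine Tendsto.limUnder_eq ?_
    simpa only [hsq] using hl.pow 2
  have hdiff : T.IsFormApprox 0 (fun n => u n - v n) := by
    refine ⟨by simpa using hu.1.sub hv.1, ?_⟩
    refine squeeze_zero (fun _ => T.nonneg _) (fun p => ?_)
      (by simpa using (hu.2.const_mul 2).add (hv.2.const_mul 2))
    have h := T.energy_add_le (u p.1 - u p.2) (-(v p.1 - v p.2))
    have h3 : T.energy (-(v p.1 - v p.2)) = T.energy (v p.1 - v p.2) := by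
      simpa using T.energy_smul (-1) (v p.1 - v p.2)
    have h4 : u p.1 - v p.1 - (u p.2 - v p.2) = u p.1 - u p.2 + -(v p.1 - v p.2) := by abel
    simp only [h4]
    rwa [h3] at h
  have h0 : Tendsto (fun n => √(T.energy (u n - v n))) atTop (𝓝 0) := by
    simpa using (T.tendsto_energy_zero hdiff).sqrt
  have h1 : Tendsto (fun n => √(T.energy (u n)) - √(T.energy (v n))) atTop (𝓝 0) :=
    squeeze_zero_norm (fun n => T.abs_sqrt_energy_sub_le _ _) h0
  have h2 : Tendsto (fun n => √(T.energy (u n))) atTop (𝓝 l) := by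
    simpa using h1.add hl
  rw [hform]
  simpa only [hsq] using h2.pow 2

/-- The bounded operator `R` is the resolvent `(T + 1)⁻¹`. -/
def IsResolvent (T : PosSelfAdjoint E) (R : E →L[ℂ] E) : Prop :=
  (∀ x : E, ∃ h : R x ∈ T.op.domain, T.op ⟨R x, h⟩ + R x = x) ∧
    ∀ x : T.op.domain, R (T.op x + x) = x

/-- Two positive self-adjoint operators commute (in the strong sense): their resolvents, which
exist because `-1` is not in the spectrum of a positive operator, commute. -/
def StronglyCommute (S T : PosSelfAdjoint E) : Prop :=
  ∃ R R' : E →L[ℂ] E, S.IsResolvent R ∧ T.IsResolvent R' ∧ Commute R R'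

/-- The relative form bound of `B` with respect to `A`: the least `β ≥ 0` with `B ≤ β A` on
`Q(A)`. It is finite for `A ≥ 1` and `Q(A) ⊆ Q(B)`, by the closed graph theorem. -/
noncomputable def relFormBound (A B : PosSelfAdjoint E) (hQ : A.formDomain ≤ B.formDomain) : ℝ :=
  sSup {r | ∃ x : A.formDomain, A.form x ≤ 1 ∧ r = B.form (Submodule.inclusion hQ x)}

/-- `x : [0, 1) → E` is a solution of `i ẋ(t) = H(t) x(t)` in `Q(A)*`, `x(0) = x₀`, in the class
`L^∞(0, 1; Q(A)) ∩ C⁰([0, 1); E)`. Here `H t` are sesquilinear forms on `Q(A)`, conjugate linear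
in the first argument, `z` is the `Q(A)`-valued representative of `x`, and the time derivative is
the distributional one: for all `φ ∈ C_c^∞(0, 1)` one has
`-∫ φ'(t) i x(t) dt = ∫ φ(t) H(t) x(t) dt` as functionals on `Q(A)`. -/
structure IsSolution (A : PosSelfAdjoint E)
    (H : ℝ → A.formDomain →ₗ⋆[ℂ] A.formDomain →ₗ[ℂ] ℂ) (x₀ : A.formDomain) (x : ℝ → E) :
    Prop where
  continuousOn : ContinuousOn x (Ico 0 1)
  initial : x 0 = x₀
  equation : ∃ z : ℝ → A.formDomain,
    (∀ᵐ t ∂(volume.restrict (Ioo (0 : ℝ) 1)), (z t : E) = x t) ∧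
    (∃ M : ℝ, ∀ᵐ t ∂(volume.restrict (Ioo (0 : ℝ) 1)), A.form (z t) ≤ M) ∧
    ∀ (y : A.formDomain) (φ : ℝ → ℝ), ContDiff ℝ ∞ φ → HasCompactSupport φ →
      tsupport φ ⊆ Ioo 0 1 →
      -∫ t in Ioo (0 : ℝ) 1, ((deriv φ t : ℝ) : ℂ) * (Complex.I * inner ℂ (y : E) (z t : E)) =
        ∫ t in Ioo (0 : ℝ) 1, (φ t : ℂ) * H t y (z t)

end PosSelfAdjoint

/-! ### Square roots, approximate identities and weak limits for bounded operators -/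

section BoundedOperators

variable {E : Type*} [NormedAddCommGroup E] [InnerProductSpace ℂ E] [CompleteSpace E]

/-! All unbounded data are first moved into bounded operators. With `ρ = (A + 1)^(-1/2)` and `S = (B
+ 1)⁻¹`, the form domain `Q(A)` is the range of `ρ`, the form of `A` at `ρ w` is `‖w‖² - ‖ρ w‖²`
(`defectForm`), and `H(t)` pulls back to a bounded self-adjoint operator `k(t)`, Lipschitz in `t` by
(b); see `PosSelfAdjoint.exists_isEvolutionData`. For `x = ρ w` the equation tested on `ρ y` reads
`d/dt ⟨ρ² y, w⟩ = -i ⟨y, k(t) w⟩`.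

Existence rests on the energy `⟨x, H(t) x⟩ + C ⟨x, B x⟩`, which dominates `C⁻¹ ⟨x, A x⟩` by (a).
Formally, the flow conserves the first term up to the explicit derivative of `H`, and the second
changes only through `i[H, B]`, so the derivative is at most a multiple of `⟨x, A x⟩` and Grönwall's
inequality applies. To justify this, `H` is replaced by `J H J` with a contraction `J = ρ N` that
commutes with the resolvents of `A` and `B` and smooths with respect to both. Then `i[J H J, B] = J
i[H, B] J`, so the constants do not depend on `J`. The state `ψ` of the regularized flow has energy
`⟨J ψ, H J ψ⟩ + C ⟨ψ, B ψ⟩`, which still controls `⟨J ψ, A J ψ⟩` because `J` decreases the form of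
`B` (`IsEvolutionData.exists_regularized`). As `J` tends strongly to the identity, weak limits of `J
ψ` solve the equation and inherit the bound (`IsEvolutionData.exists_weak_solution`).

Uniqueness follows from linearity and conservation of the norm (`IsWeakEvolution.norm_eq`). Instead
of a product rule for the pairing of `Q(A)` with `Q(A)*`, the proof uses `‖x(s)‖² ≥ 2 Re ⟨x(t),
x(s)⟩ - ‖x(t)‖²`: the right side touches the left at `s = t` and has zero derivative there, which
forces the left side to be constant. `exists_isWeakEvolution_of_distributional` brings every
distributional solution into this pointwise setting. -/

theorem IsSelfAdjoint.inner_comm {T : E →L[ℂ] E} (hT : IsSelfAdjoint T) (x y : E) :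
    inner ℂ (T x) y = inner ℂ x (T y) :=
  hT.isSymmetric x y

theorem IsSelfAdjoint.nonneg_of_re_inner {T : E →L[ℂ] E} (hT : IsSelfAdjoint T)
    (hpos : ∀ w, 0 ≤ (inner ℂ w (T w)).re) : 0 ≤ T := by
  rw [ContinuousLinearMap.nonneg_iff_isPositive, ContinuousLinearMap.isPositive_def']
  refine ⟨hT, fun w => ?_⟩
  rw [ContinuousLinearMap.reApplyInnerSelf_apply, hT.inner_comm]
  exact hpos w

/-- A bounded positive operator has a self-adjoint square root in its bicommutant. -/
theorem exists_selfAdjoint_sqrt {T : E →L[ℂ] E} (hT : IsSelfAdjoint T)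
    (hpos : ∀ w, 0 ≤ (inner ℂ w (T w)).re) :
    ∃ ρ : E →L[ℂ] E, IsSelfAdjoint ρ ∧ (∀ w, ρ (ρ w) = T w) ∧
      ∀ X : E →L[ℂ] E, Commute T X → Commute ρ X := by
  have h0 := hT.nonneg_of_re_inner hpos
  refine ⟨CFC.sqrt T, (CFC.sqrt_nonneg T).isSelfAdjoint, fun w => ?_, fun X hX => ?_⟩
  · rw [← mul_apply_eq_comp, CFC.sqrt_mul_sqrt_self T h0]
  · rw [CFC.sqrt_eq_cfc]
    exact hX.cfc_nnreal _

theorem norm_sq_eq_re_inner_of_sqrt {T ρ : E →L[ℂ] E} (hρ : IsSelfAdjoint ρ)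
    (h : ∀ w, ρ (ρ w) = T w) (w : E) : ‖ρ w‖ ^ 2 = (inner ℂ w (T w)).re := by
  rw [← h, ← hρ.inner_comm, inner_self_eq_norm_sq_to_K]
  norm_cast

/-- The form of a positive operator decreases under contractions commuting with it. -/
theorem re_inner_apply_le_of_commute {T J : E →L[ℂ] E} (hT : IsSelfAdjoint T)
    (hpos : ∀ w, 0 ≤ (inner ℂ w (T w)).re) (hJ : Commute T J) (hJ1 : ‖J‖ ≤ 1) (w : E) :
    (inner ℂ (J w) (T (J w))).re ≤ (inner ℂ w (T w)).re := by
  obtain ⟨ρ, hρ, hρ2, hc⟩ := exists_selfAdjoint_sqrt hT hpos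
  rw [← norm_sq_eq_re_inner_of_sqrt hρ hρ2, ← norm_sq_eq_re_inner_of_sqrt hρ hρ2]
  have h1 : ρ (J w) = J (ρ w) := congrArg (fun X : E →L[ℂ] E => X w) (hc J hJ).eq
  rw [h1]
  gcongr
  simpa using J.le_of_opNorm_le hJ1 (ρ w)

/-- The orthogonal complement of the range of a self-adjoint operator is its kernel. -/
theorem IsSelfAdjoint.denseRange_of_injective {T : E →L[ℂ] E} (hT : IsSelfAdjoint T)
    (hinj : Function.Injective T) : DenseRange T := by
  have h : (LinearMap.range (T : E →ₗ[ℂ] E)).topologicalClosure = ⊤ := by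
    rw [Submodule.topologicalClosure_eq_top_iff, Submodule.eq_bot_iff]
    intro v hv
    rw [Submodule.mem_orthogonal] at hv
    apply hinj
    rw [map_zero]
    refine ext_inner_left ℂ fun y => ?_
    rw [← hT.inner_comm, inner_zero_right]
    exact hv _ ⟨y, rfl⟩
  have := Submodule.dense_iff_topologicalClosure_eq_top.mpr h
  exact this

/-- Approximate identities of the form `T * G n` for an injective self-adjoint operator `T`. -/
theorem exists_approxIdentity {T : E →L[ℂ] E} (hT : IsSelfAdjoint T)
    (hinj : Function.Injective T) :
    ∃ G : ℕ → E →L[ℂ] E, (∀ n, IsSelfAdjoint (G n)) ∧ (∀ n, ‖T * G n‖ ≤ 1) ∧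
      (∀ n (X : E →L[ℂ] E), Commute T X → Commute (G n) X) ∧
      ∀ v, Tendsto (fun n => T (G n v)) atTop (𝓝 v) := by
  -- Take `G n = T (T² + ε)⁻¹` with `ε = 1 / (n + 1)`. Then `T * G n = T² (T² + ε)⁻¹` is a
  -- contraction. On the dense range of `T` its error is `-ε T (T² + ε)⁻¹` applied to a preimage,
  -- and this operator has norm at most `√ε` since `|r| √ε ≤ r² + ε`.
  have hpos : ∀ (n : ℕ) (r : ℝ), 0 < r ^ 2 + 1 / ((n : ℝ) + 1) := fun n r => by positivity
  have hcont : ∀ n : ℕ, Continuous fun r : ℝ => r / (r ^ 2 + 1 / ((n : ℝ) + 1)) := fun n =>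
    continuous_id.div (by fun_prop) fun r => (hpos n r).ne'
  have hmul : ∀ n : ℕ, T * cfc (fun r : ℝ => r / (r ^ 2 + 1 / ((n : ℝ) + 1))) T =
      cfc (fun r : ℝ => r * (r / (r ^ 2 + 1 / ((n : ℝ) + 1)))) T := fun n => by
    rw [cfc_mul (fun r : ℝ => r) _ T (by fun_prop) (hcont n).continuousOn, cfc_id' ℝ T]
  have hle : ∀ n : ℕ, ‖T * cfc (fun r : ℝ => r / (r ^ 2 + 1 / ((n : ℝ) + 1))) T‖ ≤ 1 := fun n => by
    rw [hmul]
    refine norm_cfc_le zero_le_one fun r _ => ?_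
    have h1 : (0 : ℝ) < 1 / ((n : ℝ) + 1) := by positivity
    rw [Real.norm_eq_abs, ← mul_div_assoc, abs_div, abs_of_pos (hpos n r), div_le_one (hpos n r),
      abs_of_nonneg (mul_self_nonneg r)]
    nlinarith
  refine ⟨fun n => cfc (fun r : ℝ => r / (r ^ 2 + 1 / ((n : ℝ) + 1))) T,
    fun n => cfc_predicate _ _, hle, fun n X hX => hX.cfc_real _, fun v => ?_⟩
  have hrange : ∀ (n : ℕ) (y : E),
      ‖T (cfc (fun r : ℝ => r / (r ^ 2 + 1 / ((n : ℝ) + 1))) T (T y)) - T y‖ ≤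
        √(1 / ((n : ℝ) + 1)) * ‖y‖ := by
    intro n y
    have h1 : T * cfc (fun r : ℝ => r / (r ^ 2 + 1 / ((n : ℝ) + 1))) T * T - T =
        cfc (fun r : ℝ => r * (r / (r ^ 2 + 1 / ((n : ℝ) + 1))) * r - r) T := by
      have hc := (hcont n)
      rw [hmul, cfc_sub (fun r : ℝ => r * (r / (r ^ 2 + 1 / ((n : ℝ) + 1))) * r) (fun r => r) T
        (by fun_prop) (by fun_prop), cfc_mul (fun r : ℝ => r * (r / (r ^ 2 + 1 / ((n : ℝ) + 1))))
        (fun r => r) T (by fun_prop) (by fun_prop), cfc_id' ℝ T]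
    have h2 : ‖T * cfc (fun r : ℝ => r / (r ^ 2 + 1 / ((n : ℝ) + 1))) T * T - T‖ ≤
        √(1 / ((n : ℝ) + 1)) := by
      rw [h1]
      refine norm_cfc_le (Real.sqrt_nonneg _) fun r _ => ?_
      set ε := 1 / ((n : ℝ) + 1) with hε
      have hε0 : 0 < ε := by positivity
      have h3 : r * (r / (r ^ 2 + ε)) * r - r = -(r * ε) / (r ^ 2 + ε) := by
        field_simp
        ring
      rw [h3, Real.norm_eq_abs, abs_div, abs_of_pos (hpos n r), div_le_iff₀ (hpos n r), abs_neg,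
        abs_mul, abs_of_pos hε0]
      have h4 := Real.mul_self_sqrt hε0.le
      have h5 := Real.sqrt_pos.mpr hε0
      rw [← sq_abs]
      have h6 : |r| * √ε ≤ |r| ^ 2 + √ε * √ε := by nlinarith [sq_nonneg (|r| - √ε), abs_nonneg r]
      calc |r| * ε = √ε * (|r| * √ε) := by rw [← h4]; ring_nf; simp [Real.sq_sqrt hε0.le]
        _ ≤ √ε * (|r| ^ 2 + √ε * √ε) := by gcongr
        _ = _ := by rw [h4]
    exact ContinuousLinearMap.le_of_opNorm_le _ h2 y
  have hlim : Tendsto (fun n : ℕ => √(1 / ((n : ℝ) + 1))) atTop (𝓝 0) := by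
    simpa using tendsto_one_div_add_atTop_nhds_zero_nat.sqrt
  rw [Metric.tendsto_atTop]
  intro ε hε
  obtain ⟨y, hy⟩ := (hT.denseRange_of_injective hinj).exists_dist_lt v (ε := ε / 4) (by linarith)
  have hlim' := hlim.mul_const ‖y‖
  rw [zero_mul] at hlim'
  obtain ⟨n₀, hn₀⟩ := Metric.tendsto_atTop.mp hlim' (ε / 4) (by linarith)
  refine ⟨n₀, fun n hn => ?_⟩
  have h1 := (abs_lt.mp (Real.dist_0_eq_abs _ ▸ hn₀ n hn)).2
  have h2 := hrange n y
  have h3 := ContinuousLinearMap.le_of_opNorm_le _ (hle n) (v - T y)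
  rw [dist_eq_norm] at hy ⊢
  rw [mul_apply_eq_comp, map_sub, map_sub, one_mul] at h3
  set a := T ((cfc (fun r : ℝ => r / (r ^ 2 + 1 / ((n : ℝ) + 1))) T) v)
  set b := T ((cfc (fun r : ℝ => r / (r ^ 2 + 1 / ((n : ℝ) + 1))) T) (T y))
  calc ‖a - v‖ = ‖(a - b) + (b - T y) - (v - T y)‖ := by congr 1; abel
    _ ≤ ‖a - b‖ + ‖b - T y‖ + ‖v - T y‖ :=
      (norm_sub_le _ _).trans (add_le_add_left (norm_add_le _ _) _)
    _ < ε := by linarith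

/-- Bounded families have weak limits along ultrafilters. -/
theorem exists_weak_limit {ι : Type*} (U : Ultrafilter ι) {w : ι → E} {M : ℝ}
    (hw : ∀ᶠ i in (U : Filter ι), ‖w i‖ ≤ M) :
    ∃ w' : E, ‖w'‖ ≤ M ∧ ∀ v, Tendsto (fun i => inner ℂ v (w i)) U (𝓝 (inner ℂ v w')) := by
  -- Banach–Alaoglu for the functionals `⟨w i, ·⟩`; a conjugation at the end swaps the slots.
  have hc := WeakDual.isCompact_closedBall (𝕜 := ℂ) (E := E) 0 M
  let f : ι → WeakDual ℂ E := fun i =>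
    StrongDual.toWeakDual (InnerProductSpace.toDual ℂ E (w i))
  have hf : ∀ᶠ i in (U : Filter ι),
      f i ∈ WeakDual.toStrongDual ⁻¹' Metric.closedBall (0 : StrongDual ℂ E) M := by
    filter_upwards [hw] with i hi
    have : ‖InnerProductSpace.toDual ℂ E (w i)‖ ≤ M := by
      rw [LinearIsometryEquiv.norm_map]; exact hi
    simpa [f] using this
  obtain ⟨g, hg, hlim⟩ := hc.ultrafilter_le_nhds (U.map f)
    (tendsto_principal.mpr hf)
  refine ⟨(InnerProductSpace.toDual ℂ E).symm (WeakDual.toStrongDual g), ?_, fun v => ?_⟩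
  · rw [LinearIsometryEquiv.norm_map]
    simpa using hg
  · have h1 : Tendsto (fun i => f i v) U (𝓝 (g v)) :=
      ((WeakDual.eval_continuous v).tendsto g).comp hlim
    have h2 := (Complex.continuous_conj.tendsto _).comp h1
    rw [← inner_conj_symm, InnerProductSpace.toDual_symm_apply]
    refine h2.congr fun i => ?_
    simp [f]

end BoundedOperators

/-! ### Linear equations, comparison principles and distributional derivatives in one variable -/

section Calculus

/-- The radial retraction onto a ball is Lipschitz. -/
theorem norm_radial_retraction_sub_le {E : Type*} [NormedAddCommGroup E] [NormedSpace ℝ E]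
    {r : ℝ} (hr : 0 < r) (x y : E) :
    ‖(r / max r ‖x‖) • x - (r / max r ‖y‖) • y‖ ≤ 2 * ‖x - y‖ := by
  have hx : 0 < max r ‖x‖ := lt_max_of_lt_left hr
  have hy : 0 < max r ‖y‖ := lt_max_of_lt_left hr
  have h1 : (r / max r ‖x‖) • x - (r / max r ‖y‖) • y =
      (r / max r ‖x‖) • (x - y) + (r / max r ‖x‖ - r / max r ‖y‖) • y := by
    rw [smul_sub, sub_smul]; abel
  have h2 : ‖(r / max r ‖x‖) • (x - y)‖ ≤ ‖x - y‖ := by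
    rw [norm_smul, Real.norm_of_nonneg (by positivity)]
    exact mul_le_of_le_one_left (norm_nonneg _) ((div_le_one hx).mpr (le_max_left _ _))
  have h3 : ‖(r / max r ‖x‖ - r / max r ‖y‖) • y‖ ≤ ‖x - y‖ := by
    have h4 : r / max r ‖x‖ - r / max r ‖y‖ =
        (r / max r ‖x‖) * ((max r ‖y‖ - max r ‖x‖) / max r ‖y‖) := by
      field_simp
    have h5 : |max r ‖y‖ - max r ‖x‖| ≤ ‖x - y‖ := by
      refine (abs_max_sub_max_le_max _ _ _ _).trans ?_
      rw [sub_self, abs_zero, norm_sub_rev]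
      exact max_le (norm_nonneg _) (abs_norm_sub_norm_le _ _)
    rw [norm_smul, h4, norm_mul, Real.norm_of_nonneg (r := r / max r ‖x‖) (by positivity),
      norm_div, Real.norm_eq_abs, Real.norm_of_nonneg hy.le]
    have h6 : r / max r ‖x‖ ≤ 1 := (div_le_one hx).mpr (le_max_left _ _)
    have h7 : ‖y‖ / max r ‖y‖ ≤ 1 := (div_le_one hy).mpr (le_max_right _ _)
    calc r / max r ‖x‖ * (|max r ‖y‖ - max r ‖x‖| / max r ‖y‖) * ‖y‖
        = (r / max r ‖x‖) * (|max r ‖y‖ - max r ‖x‖|) * (‖y‖ / max r ‖y‖) := by ring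
      _ ≤ 1 * ‖x - y‖ * 1 := by gcongr
      _ = ‖x - y‖ := by ring
  rw [h1]
  linarith [norm_add_le ((r / max r ‖x‖) • (x - y)) ((r / max r ‖x‖ - r / max r ‖y‖) • y)]

/-- Global solvability of linear ordinary differential equations on `[0, 1]`. -/
theorem exists_linear_ode_solution {E : Type*} [NormedAddCommGroup E] [NormedSpace ℂ E]
    [CompleteSpace E] {L : ℝ → E →L[ℂ] E} (hL : Continuous L) (u₀ : E) :
    ∃ u : ℝ → E, u 0 = u₀ ∧
      ∀ t ∈ Icc (0 : ℝ) 1, HasDerivWithinAt u (L t (u t)) (Icc 0 1) t := by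
  obtain ⟨Λ₀, hΛ₀⟩ := (isCompact_Icc (a := (0 : ℝ)) (b := 1)).exists_bound_of_continuousOn
    hL.continuousOn
  obtain ⟨Λ, hΛ, hΛ0⟩ : ∃ Λ : ℝ, (∀ t ∈ Icc (0 : ℝ) 1, ‖L t‖ ≤ Λ) ∧ 0 ≤ Λ :=
    ⟨max Λ₀ 0, fun t ht => (hΛ₀ t ht).trans (le_max_left _ _), le_max_right _ _⟩
  -- The radius exceeds the Grönwall bound on `[0, 1]`, so the solution never sees the truncation
  -- `ψ`. The truncated field is bounded by `Λ * r` everywhere, which lets Picard–Lindelöf cover the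
  -- whole unit interval at once.
  obtain ⟨r, hr, hru⟩ : ∃ r : ℝ, 0 < r ∧ ‖u₀‖ * Real.exp Λ ≤ r :=
    ⟨‖u₀‖ * Real.exp Λ + 1, by positivity, by linarith⟩
  let ψ : E → E := fun x => (r / max r ‖x‖) • x
  have hmax : ∀ x : E, 0 < max r ‖x‖ := fun x => lt_max_of_lt_left hr
  have hψr : ∀ x, ‖ψ x‖ ≤ r := fun x => by
    rw [norm_smul, Real.norm_of_nonneg (div_nonneg hr.le (hmax x).le), div_mul_eq_mul_div,
      div_le_iff₀ (hmax x)]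
    gcongr
    exact le_max_right _ _
  have hψx : ∀ x, ‖ψ x‖ ≤ ‖x‖ := fun x => by
    rw [norm_smul, Real.norm_of_nonneg (div_nonneg hr.le (hmax x).le)]
    exact mul_le_of_le_one_left (norm_nonneg _) ((div_le_one (hmax x)).mpr (le_max_left _ _))
  have hψ : ∀ x, ‖x‖ ≤ r → ψ x = x := fun x hx => by
    simp only [ψ, max_eq_left hx, div_self hr.ne', one_smul]
  have hPL : IsPicardLindelof (fun t x => L t (ψ x)) (tmin := 0) (tmax := 1)
      ⟨0, by simp⟩ u₀ (Real.toNNReal (Λ * r)) 0 (Real.toNNReal (Λ * r))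
      (Real.toNNReal (Λ * 2)) := by
    have hΛr : 0 ≤ Λ * r := by positivity
    refine ⟨fun t ht => LipschitzOnWith.of_dist_le_mul fun x _ y _ => ?_, fun x _ => ?_,
      fun t ht x _ => ?_, ?_⟩
    · rw [dist_eq_norm, dist_eq_norm, ← map_sub, Real.coe_toNNReal _ (by positivity), mul_assoc]
      exact ((L t).le_of_opNorm_le (hΛ t ht) _).trans
        (mul_le_mul_of_nonneg_left (norm_radial_retraction_sub_le hr x y) hΛ0)
    · exact (hL.clm_apply continuous_const).continuousOn
    · rw [Real.coe_toNNReal _ hΛr]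
      exact ((L t).le_of_opNorm_le (hΛ t ht) _).trans (mul_le_mul_of_nonneg_left (hψr x) hΛ0)
    · simp [Real.coe_toNNReal _ hΛr]
  obtain ⟨u, hu0, hu⟩ := hPL.exists_eq_forall_mem_Icc_hasDerivWithinAt₀
  refine ⟨u, hu0, fun t ht => ?_⟩
  have hbound : ∀ t ∈ Icc (0 : ℝ) 1, ‖u t‖ ≤ r := by
    intro t ht
    have h := norm_le_gronwallBound_of_norm_deriv_right_le (f := u)
      (f' := fun t => L t (ψ (u t))) (δ := ‖u₀‖) (K := Λ) (ε := 0) (a := 0) (b := 1)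
      (fun t ht => (hu t ht).continuousWithinAt)
      (fun t ht => (hu t (Ico_subset_Icc_self ht)).mono_of_mem_nhdsWithin
        (Icc_mem_nhdsGE_of_mem ht)) (le_of_eq (congrArg norm hu0))
      (fun t ht => by
        rw [add_zero]
        exact ((L t).le_of_opNorm_le (hΛ t (Ico_subset_Icc_self ht)) _).trans
          (mul_le_mul_of_nonneg_left (hψx _) hΛ0)) t ht
    rw [gronwallBound_ε0, sub_zero] at h
    refine h.trans (le_trans ?_ hru)
    gcongr
    exact mul_le_of_le_one_right hΛ0 ht.2
  have h := hu t ht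
  rwa [hψ _ (hbound t ht)] at h

/-- A continuous function touched from below at every point by a function with vanishing
derivative there does not decrease. -/
theorem le_of_lower_support {f : ℝ → ℝ} {a b : ℝ} (hab : a ≤ b) (hf : ContinuousOn f (Icc a b))
    (h : ∀ t ∈ Ico a b, ∃ m : ℝ → ℝ, HasDerivWithinAt m 0 (Ioi t) t ∧ m t = f t ∧
      ∀ᶠ s in 𝓝[>] t, m s ≤ f s) : f a ≤ f b := by
  have hslope : ∀ t ∈ Ico a b, ∀ r, (0 : ℝ) < r → ∃ᶠ s in 𝓝[>] t, slope (fun t => -f t) t s < r := by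
    intro t ht r hr
    obtain ⟨m, hm, hmt, hle⟩ := h t ht
    have h1 := hasDerivWithinAt_iff_tendsto_slope' (self_notMem_Ioi) |>.mp hm
    have h2 : ∀ᶠ s in 𝓝[>] t, -r < slope m t s :=
      h1.eventually (lt_mem_nhds (by linarith))
    refine Eventually.frequently ?_
    filter_upwards [h2, hle, self_mem_nhdsWithin] with s hs1 hs2 hs3
    have hs3' : 0 < s - t := sub_pos.mpr hs3
    rw [slope_def_field, lt_div_iff₀ hs3'] at hs1
    rw [slope_def_field, div_lt_iff₀ hs3']
    linarith
  by_contra! hlt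
  -- A barrier of slope `ε > 0` provides the strict inequality needed where `-f` meets it.
  have hε : ∀ ε > 0, f a - f b ≤ ε * (b - a) := by
    intro ε hε
    have := image_le_of_liminf_slope_right_lt_deriv_boundary' (f' := fun _ => 0) hf.neg hslope
      (B := fun t => -f a + ε * (t - a)) (B' := fun _ => ε) (by simp) (by fun_prop)
      (fun t _ => by
        simpa using (((hasDerivAt_id t).sub_const a).const_mul ε).const_add (-f a)
          |>.hasDerivWithinAt)
      (fun t _ _ => hε) (right_mem_Icc.mpr hab)
    rw [Pi.neg_apply] at this
    linarith
  rcases hab.eq_or_lt with rfl | hab'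
  · exact lt_irrefl _ hlt
  · have := hε ((f a - f b) / (2 * (b - a))) (by
      apply div_pos <;> linarith)
    have h3 : (f a - f b) / (2 * (b - a)) * (b - a) = (f a - f b) / 2 := by
      field_simp
    linarith

/-- A continuous function touched from below at every point by a function with
vanishing derivative there is constant. -/
theorem eq_of_lower_support {f : ℝ → ℝ} {a b : ℝ} (hab : a ≤ b) (hf : ContinuousOn f (Icc a b))
    (h : ∀ t ∈ Icc a b, ∃ m : ℝ → ℝ, HasDerivAt m 0 t ∧ m t = f t ∧
      ∀ s, m s ≤ f s) : f a = f b := by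
  refine le_antisymm (le_of_lower_support hab hf fun t ht => ?_) ?_
  · obtain ⟨m, hm, hmt, hle⟩ := h t (Ico_subset_Icc_self ht)
    exact ⟨m, hm.hasDerivWithinAt, hmt, Eventually.of_forall fun s => hle s⟩
  -- The support functions are two-sided, so time reversal gives the other inequality.
  · have hmaps : MapsTo (fun s => a + b - s) (Icc a b) (Icc a b) := fun s hs =>
      ⟨by linarith [hs.2], by linarith [hs.1]⟩
    have := le_of_lower_support (f := fun s => f (a + b - s)) hab
      (hf.comp (by fun_prop) hmaps) fun t ht => by
        obtain ⟨m, hm, hmt, hle⟩ := h (a + b - t) (hmaps (Ico_subset_Icc_self ht))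
        refine ⟨fun s => m (a + b - s), ?_, hmt, Eventually.of_forall fun s => hle _⟩
        have h1 : HasDerivAt (fun s => a + b - s) (-1) t := by
          simpa using (hasDerivAt_id t).const_sub (a + b)
        have h2 := HasDerivAt.scomp t hm h1
        rw [smul_zero] at h2
        exact h2.hasDerivWithinAt
    simpa using this

/-- A Lipschitz function on `[0, 1)` extends continuously to the real line. -/
theorem exists_continuous_extension_of_lipschitz {F : Type*} [NormedAddCommGroup F]
    [CompleteSpace F] {h : ℝ → F} {K : NNReal} (hh : LipschitzOnWith K h (Ico 0 1)) :
    ∃ k : ℝ → F, Continuous k ∧ EqOn k h (Ico 0 1) := by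
  have hc : ContinuousOn h (Ico 0 1) := hh.continuousOn
  have hcl : closure (Ico (0 : ℝ) 1) = Icc 0 1 := closure_Ico zero_ne_one
  have hlim : ∀ t ∈ Icc (0 : ℝ) 1, ∃ y, Tendsto h (𝓝[Ico 0 1] t) (𝓝 y) := by
    intro t ht
    have : (𝓝[Ico (0 : ℝ) 1] t).NeBot := mem_closure_iff_nhdsWithin_neBot.mp (hcl ▸ ht)
    have h1 : Cauchy (map h (𝓝[Ico 0 1] t)) := by
      have hu := hh.uniformContinuousOn
      refine ⟨inferInstance, ?_⟩
      rw [prod_map_map_eq]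
      refine Tendsto.mono_left hu ?_
      refine le_inf ((cauchy_nhds (a := t)).mono' ?_ nhdsWithin_le_nhds).2 ?_
      · infer_instance
      · rw [← prod_principal_principal]
        exact Filter.prod_mono inf_le_right inf_le_right
    exact CompleteSpace.complete h1
  have hext : ContinuousOn (extendFrom (Ico 0 1) h) (Icc 0 1) :=
    continuousOn_extendFrom (hcl ▸ Subset.rfl) hlim
  refine ⟨IccExtend zero_le_one ((Icc 0 1).domRestrict (extendFrom (Ico 0 1) h)),
    hext.domRestrict.Icc_extend', fun t ht => ?_⟩
  rw [IccExtend_of_mem _ _ (Ico_subset_Icc_self ht)]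
  exact extendFrom_eq (subset_closure ht) (hc t ht)

/-- Integration by parts against test functions on `(0, 1)`. -/
theorem integral_deriv_smul_eq_neg {g g' : ℝ → ℂ}
    (hg : ∀ t ∈ Ioo (0 : ℝ) 1, HasDerivAt g (g' t) t) (hg' : ContinuousOn g' (Ioo 0 1))
    {φ : ℝ → ℝ} (hφ : ContDiff ℝ ∞ φ) (hc : HasCompactSupport φ) (hs : tsupport φ ⊆ Ioo 0 1) :
    ∫ t in Ioo (0 : ℝ) 1, deriv φ t • g t = -∫ t in Ioo (0 : ℝ) 1, φ t • g' t := by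
  have hφ1 : Differentiable ℝ φ := hφ.differentiable (by simp)
  have hdφ : Continuous (deriv φ) := hφ.continuous_deriv (by simp)
  have hgc : ContinuousOn g (Ioo 0 1) := fun t ht => (hg t ht).continuousAt.continuousWithinAt
  have hs' : tsupport (deriv φ) ⊆ Ioo 0 1 := (tsupport_deriv_subset).trans hs
  have hzero : ∀ {ψ : ℝ → ℝ} (f : ℝ → ℂ), tsupport ψ ⊆ Ioo 0 1 →
      ∀ t, t ∉ Ioo (0 : ℝ) 1 → ψ t • f t = 0 := fun f hψ t ht => by
    rw [image_eq_zero_of_notMem_tsupport fun h => ht (hψ h), zero_smul]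
  have hcont : ∀ {ψ : ℝ → ℝ} {f : ℝ → ℂ}, Continuous ψ → ContinuousOn f (Ioo 0 1) →
      tsupport ψ ⊆ Ioo 0 1 → Continuous fun t => ψ t • f t := fun hψ hf hsψ =>
    (hψ.continuousOn.smul hf).continuous_of_tsupport_subset isOpen_Ioo
      ((tsupport_smul_subset_left _ _).trans hsψ)
  have hi1 : Integrable fun t => deriv φ t • g t :=
    (hcont hdφ hgc hs').integrable_of_hasCompactSupport hc.deriv.smul_right
  have hi2 : Integrable fun t => φ t • g' t :=
    (hcont hφ.continuous hg' hs).integrable_of_hasCompactSupport hc.smul_right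
  have hi3 : Integrable fun t => φ t • g t :=
    (hcont hφ.continuous hgc hs).integrable_of_hasCompactSupport hc.smul_right
  have hderiv : ∀ t, HasDerivAt (fun t => φ t • g t) (φ t • g' t + deriv φ t • g t) t := by
    intro t
    by_cases ht : t ∈ Ioo (0 : ℝ) 1
    · exact (hφ1 t).hasDerivAt.smul (hg t ht)
    · have ht' : t ∉ tsupport φ := fun h => ht (hs h)
      rw [hzero g' hs t ht, hzero g hs' t ht, add_zero]
      refine (hasDerivAt_const t (0 : ℂ)).congr_of_eventuallyEq ?_
      filter_upwards [notMem_tsupport_iff_eventuallyEq.mp ht'] with s hs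
      rw [hs, Pi.zero_apply, zero_smul]
  have h0 := integral_eq_zero_of_hasDerivAt_of_integrable hderiv (hi2.add hi1) hi3
  rw [integral_add hi2 hi1] at h0
  rw [setIntegral_eq_integral_of_forall_compl_eq_zero (hzero g hs'),
    setIntegral_eq_integral_of_forall_compl_eq_zero (hzero g' hs)]
  exact eq_neg_of_add_eq_zero_right h0

/-- The du Bois-Reymond lemma: a continuous function on `(0, 1)` with vanishing distributional
derivative is constant. -/
theorem exists_eq_const_of_integral_deriv_smul_eq_zero {G : ℝ → ℂ} (hG : ContinuousOn G (Ioo 0 1))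
    (h : ∀ φ : ℝ → ℝ, ContDiff ℝ ∞ φ → HasCompactSupport φ → tsupport φ ⊆ Ioo 0 1 →
      ∫ t in Ioo (0 : ℝ) 1, deriv φ t • G t = 0) :
    ∃ c : ℂ, ∀ t ∈ Ioo (0 : ℝ) 1, G t = c := by
  let b : ContDiffBump (1 / 2 : ℝ) := ⟨1 / 8, 1 / 4, by norm_num, by norm_num⟩
  let η : ℝ → ℝ := b.normed volume
  have hη : ContDiff ℝ ∞ η := b.contDiff_normed
  have hηc : HasCompactSupport η := b.hasCompactSupport_normed
  have hηs : tsupport η ⊆ Icc (1 / 4) (3 / 4) := by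
    rw [show tsupport η = Metric.closedBall (1 / 2 : ℝ) (1 / 4) from b.tsupport_normed_eq,
      Real.closedBall_eq_Icc]
    norm_num
  have hη1 : ∫ t, η t = 1 := b.integral_normed
  have hηI : tsupport η ⊆ Ioo 0 1 := hηs.trans fun t ht =>
    ⟨by linarith [ht.1], by linarith [ht.2]⟩
  have hint : ∀ {ψ : ℝ → ℝ}, Continuous ψ → HasCompactSupport ψ → tsupport ψ ⊆ Ioo 0 1 →
      Integrable fun t => ψ t • G t := fun hψ hψc hψs =>
    ((hψ.continuousOn.smul hG).continuous_of_tsupport_subset isOpen_Ioo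
      ((tsupport_smul_subset_left _ _).trans hψs)).integrable_of_hasCompactSupport hψc.smul_right
  have hset : ∀ {ψ : ℝ → ℝ}, tsupport ψ ⊆ Ioo 0 1 →
      ∫ t in Ioo (0 : ℝ) 1, ψ t • G t = ∫ t, ψ t • G t := fun hψ =>
    setIntegral_eq_integral_of_forall_compl_eq_zero fun t ht => by
      rw [image_eq_zero_of_notMem_tsupport fun h => ht (hψ h), zero_smul]
  refine ⟨∫ t, η t • G t, ?_⟩
  set c := ∫ t, η t • G t with hcdef
  have hae : ∀ᵐ t, t ∈ Ioo (0 : ℝ) 1 → G t - c = 0 := by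
    refine isOpen_Ioo.ae_eq_zero_of_integral_contDiff_smul_eq_zero
      ((hG.sub continuousOn_const).locallyIntegrableOn measurableSet_Ioo) ?_
    intro χ hχ hχc hχs
    obtain ⟨a, b, ha0, hb1, hχab, hηab⟩ : ∃ a b : ℝ, 0 < a ∧ b < 1 ∧ tsupport χ ⊆ Icc a b ∧
        tsupport η ⊆ Icc a b := by
      rcases (tsupport χ).eq_empty_or_nonempty with he | hne
      · exact ⟨1 / 4, 3 / 4, by norm_num, by norm_num, by simp [he], hηs⟩
      · have hcomp : IsCompact (tsupport χ) := hχc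
        have h1 := hχs (hcomp.sInf_mem hne)
        have h2 := hχs (hcomp.sSup_mem hne)
        refine ⟨min (sInf (tsupport χ)) (1 / 4), max (sSup (tsupport χ)) (3 / 4),
          lt_min h1.1 (by norm_num), max_lt h2.2 (by norm_num), fun t ht => ?_, fun t ht => ?_⟩
        · exact ⟨(min_le_left _ _).trans (csInf_le hcomp.bddBelow ht),
            (le_csSup hcomp.bddAbove ht).trans (le_max_left _ _)⟩
        · exact ⟨(min_le_right _ _).trans (hηs ht).1, (hηs ht).2.trans (le_max_right _ _)⟩
    set m := ∫ t, χ t with hm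
    -- Removing the mass of `χ` makes the integral zero, so the primitive of `ψ` has compact support
    -- in `(0, 1)` and is itself an admissible test function.
    let ψ : ℝ → ℝ := fun t => χ t - m * η t
    have hψ : ContDiff ℝ ∞ ψ := hχ.sub (contDiff_const.mul hη)
    have hψ0 : ∀ t, t ∉ Icc a b → ψ t = 0 := fun t ht => by
      simp only [ψ, image_eq_zero_of_notMem_tsupport fun h => ht (hχab h),
        image_eq_zero_of_notMem_tsupport fun h => ht (hηab h), mul_zero, sub_zero]
    have hχi : Integrable χ := hχ.continuous.integrable_of_hasCompactSupport hχc
    have hηi : Integrable η := hη.continuous.integrable_of_hasCompactSupport hηc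
    have hψint : ∫ t, ψ t = 0 := by
      rw [integral_sub hχi (hηi.const_mul m), integral_const_mul, hη1, mul_one, ← hm, sub_self]
    let φ : ℝ → ℝ := fun t => ∫ s in (0 : ℝ)..t, ψ s
    have hφd : ∀ t, HasDerivAt φ (ψ t) t := fun t =>
      hψ.continuous.integral_hasStrictDerivAt 0 t |>.hasDerivAt
    have hφ' : deriv φ = ψ := funext fun t => (hφd t).deriv
    have hφ : ContDiff ℝ ∞ φ := by
      rw [contDiff_infty_iff_deriv, hφ']
      exact ⟨fun t => (hφd t).differentiableAt, hψ⟩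
    have hφ0 : ∀ t, t ∉ Icc a b → φ t = 0 := by
      intro t ht
      by_cases hta : t < a
      · refine (intervalIntegral.integral_congr (g := fun _ => (0 : ℝ)) fun s hs => ?_).trans
          (by simp)
        refine hψ0 s fun hs' => ?_
        have : s ≤ max 0 t := (mem_uIcc.mp hs).elim (fun h => h.2.trans (le_max_right _ _))
          fun h => h.2.trans (le_max_left _ _)
        exact absurd hs'.1 (not_le.mpr (this.trans_lt (max_lt ha0 hta)))
      · have htb : b < t := not_le.mp fun h => ht ⟨not_lt.mp hta, h⟩
        have h0t : 0 ≤ t := ha0.le.trans (not_lt.mp hta)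
        change ∫ s in (0 : ℝ)..t, ψ s = 0
        rw [intervalIntegral.integral_of_le h0t,
          setIntegral_eq_integral_of_forall_compl_eq_zero, hψint]
        intro s hs
        exact hψ0 s fun hs' => hs ⟨ha0.trans_le hs'.1, hs'.2.trans htb.le⟩
    have hφs : tsupport φ ⊆ Icc a b :=
      closure_minimal (fun t ht => by_contra fun h => ht (hφ0 t h)) isClosed_Icc
    have hIcc : Icc a b ⊆ Ioo 0 1 := fun t ht => ⟨ha0.trans_le ht.1, ht.2.trans_lt hb1⟩
    have hφc : HasCompactSupport φ := isCompact_Icc.of_isClosed_subset (isClosed_tsupport φ) hφs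
    have key := h φ hφ hφc (hφs.trans hIcc)
    rw [hset ((tsupport_deriv_subset).trans (hφs.trans hIcc)), hφ'] at key
    have h1 : ∀ t, ψ t • G t = χ t • G t - (m : ℂ) * (η t • G t) := fun t => by
      simp only [ψ, Complex.real_smul]
      push_cast
      ring
    simp only [h1] at key
    rw [integral_sub (hint hχ.continuous hχc hχs) ((hint hη.continuous hηc hηI).const_mul _),
      integral_const_mul, ← hcdef] at key
    simp only [smul_sub]
    rw [integral_sub (hint hχ.continuous hχc hχs) (hχi.smul_const c), integral_smul_const, ← hm,
      Complex.real_smul]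
    exact key
  have hae' : G =ᵐ[volume.restrict (Ioo 0 1)] fun _ => c := by
    rw [EventuallyEq, ae_restrict_iff' measurableSet_Ioo]
    filter_upwards [hae] with t ht htI
    exact sub_eq_zero.mp (ht htI)
  exact Measure.eqOn_open_of_ae_eq hae' isOpen_Ioo hG continuousOn_const

/-- A continuous function on `(0, 1)` with continuous distributional derivative is continuously
differentiable. -/
theorem hasDerivAt_of_integral_deriv_smul_eq_neg {g g' : ℝ → ℂ} (hg : ContinuousOn g (Ioo 0 1))
    (hg' : ContinuousOn g' (Ioo 0 1))
    (h : ∀ φ : ℝ → ℝ, ContDiff ℝ ∞ φ → HasCompactSupport φ → tsupport φ ⊆ Ioo 0 1 →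
      ∫ t in Ioo (0 : ℝ) 1, deriv φ t • g t = -∫ t in Ioo (0 : ℝ) 1, φ t • g' t)
    {t : ℝ} (ht : t ∈ Ioo (0 : ℝ) 1) : HasDerivAt g (g' t) t := by
  let P : ℝ → ℂ := fun t => ∫ s in (1 / 2 : ℝ)..t, g' s
  have hP : ∀ t ∈ Ioo (0 : ℝ) 1, HasDerivAt P (g' t) t := by
    intro t ht
    have hsub : uIcc (1 / 2 : ℝ) t ⊆ Ioo 0 1 :=
      ordConnected_Ioo.uIcc_subset (by norm_num) ht
    exact intervalIntegral.integral_hasDerivAt_right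
      (hg'.mono hsub).intervalIntegrable
      (hg'.stronglyMeasurableAtFilter isOpen_Ioo t ht) (hg'.continuousAt (isOpen_Ioo.mem_nhds ht))
  have hPc : ContinuousOn P (Ioo 0 1) := fun t ht => (hP t ht).continuousAt.continuousWithinAt
  have hint : ∀ {φ : ℝ → ℝ} {f : ℝ → ℂ}, Continuous φ → HasCompactSupport φ →
      tsupport φ ⊆ Ioo 0 1 → ContinuousOn f (Ioo 0 1) → Integrable fun t => φ t • f t :=
    fun hψ hψc hψs hf =>
    ((hψ.continuousOn.smul hf).continuous_of_tsupport_subset isOpen_Ioo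
      ((tsupport_smul_subset_left _ _).trans hψs)).integrable_of_hasCompactSupport hψc.smul_right
  obtain ⟨c, hc⟩ := exists_eq_const_of_integral_deriv_smul_eq_zero (hg.sub hPc)
    fun φ hφ hφc hφs => by
      have hdφ : Continuous (deriv φ) := hφ.continuous_deriv (by simp)
      have hs' : tsupport (deriv φ) ⊆ Ioo 0 1 := (tsupport_deriv_subset).trans hφs
      simp only [Pi.sub_apply, smul_sub]
      rw [integral_sub (hint hdφ hφc.deriv hs' hg).integrableOn
        (hint hdφ hφc.deriv hs' hPc).integrableOn, h φ hφ hφc hφs,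
        integral_deriv_smul_eq_neg hP hg' hφ hφc hφs, sub_self]
  refine ((hP t ht).const_add c).congr_of_eventuallyEq ?_
  filter_upwards [isOpen_Ioo.mem_nhds ht] with s hs
  rw [← hc s hs]
  simp

end Calculus

/-! ### Bounded symmetric forms and the operators they define -/

section SesquilinearForms

variable {E : Type*} [NormedAddCommGroup E] [InnerProductSpace ℂ E]

/-- A symmetric sesquilinear form is bounded by its quadratic form. -/
theorem norm_sesq_le_of_abs_re_le {q : E →ₗ⋆[ℂ] E →ₗ[ℂ] ℂ} (hq : ∀ x y, q x y = conj (q y x))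
    {c : ℝ} (hc : ∀ x, |(q x x).re| ≤ c * ‖x‖ ^ 2) (x y : E) : ‖q x y‖ ≤ c * ‖x‖ * ‖y‖ := by
  have h1 : ∀ x y, (q x y).re ≤ c / 2 * (‖x‖ ^ 2 + ‖y‖ ^ 2) := by
    intro x y
    have h2 := (abs_le.mp (hc (x + y))).2
    have h3 := (abs_le.mp (hc (x - y))).1
    have h4 := parallelogram_law_with_norm ℂ x y
    have h5 : (q y x).re = (q x y).re := by rw [hq y x, Complex.conj_re]
    simp only [map_add, map_sub, LinearMap.add_apply, LinearMap.sub_apply, Complex.add_re,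
      Complex.sub_re, h5] at h2 h3
    have h6 : c * (‖x + y‖ ^ 2 + ‖x - y‖ ^ 2) = c * (2 * (‖x‖ ^ 2 + ‖y‖ ^ 2)) := by rw [h4]
    nlinarith
  rcases eq_or_ne x 0 with rfl | hx
  · simp
  rcases eq_or_ne y 0 with rfl | hy
  · simp
  rcases eq_or_ne (q x y) 0 with h0 | h0
  · rw [h0, norm_zero]
    have : 0 ≤ c * ‖x‖ ^ 2 := (abs_nonneg _).trans (hc x)
    have hc0 : 0 ≤ c := nonneg_of_mul_nonneg_left this (by positivity)
    positivity
  have hx' := norm_pos_iff.mpr hx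
  have hy' := norm_pos_iff.mpr hy
  have hq' := norm_pos_iff.mpr h0
  -- The scaling gives both vectors the norm `‖x‖ ‖y‖`, and the phase makes the value of `q`
  -- nonnegative; the polarized bound `h1` is then sharp enough.
  have h2 := h1 ((‖y‖ : ℂ) • x) ((conj (q x y) / ‖q x y‖ * ‖x‖ : ℂ) • y)
  have h3 : q ((‖y‖ : ℂ) • x) ((conj (q x y) / ‖q x y‖ * ‖x‖ : ℂ) • y) =
      ((‖q x y‖ * ‖x‖ * ‖y‖ : ℝ) : ℂ) := by
    rw [map_smul, LinearMap.map_smulₛₗ, LinearMap.smul_apply, smul_eq_mul, smul_eq_mul,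
      Complex.conj_ofReal]
    have h4 : q x y * conj (q x y) = (‖q x y‖ : ℂ) ^ 2 := Complex.mul_conj' _
    have h5 : (‖q x y‖ : ℂ) ≠ 0 := by exact_mod_cast hq'.ne'
    push_cast
    field_simp
    rw [← h4]
    ring
  rw [h3, Complex.ofReal_re, norm_smul, norm_smul, norm_mul, norm_div, Complex.norm_conj,
    Complex.norm_real, Complex.norm_real, Complex.norm_real, norm_norm, norm_norm, norm_norm,
    div_self hq'.ne', one_mul] at h2
  have h4 : ‖q x y‖ * (‖x‖ * ‖y‖) ≤ (c * ‖x‖ * ‖y‖) * (‖x‖ * ‖y‖) := by nlinarith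
  exact le_of_mul_le_mul_right h4 (by positivity)

theorem exists_operator_of_sesq [CompleteSpace E] {q : E →ₗ⋆[ℂ] E →ₗ[ℂ] ℂ}
    (hq : ∀ x y, q x y = conj (q y x)) {c : ℝ} (hc : ∀ x, |(q x x).re| ≤ c * ‖x‖ ^ 2) :
    ∃ h : E →L[ℂ] E, IsSelfAdjoint h ∧ ∀ x y, inner ℂ x (h y) = q x y := by
  let h := InnerProductSpace.continuousLinearMapOfBilin
    (q.mkContinuous₂ c (norm_sesq_le_of_abs_re_le hq hc))
  have h1 : ∀ x y, inner ℂ (h x) y = q x y := fun x y => by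
    rw [InnerProductSpace.continuousLinearMapOfBilin_apply]; rfl
  have h2 : ∀ x y, inner ℂ x (h y) = q x y := fun x y => by
    rw [← inner_conj_symm, h1, ← hq]
  refine ⟨h, ?_, h2⟩
  rw [ContinuousLinearMap.isSelfAdjoint_iff_isSymmetric]
  exact fun x y => (h1 x y).trans (h2 x y).symm

/-- Apply the polarized form bound to the pair `D y`, `y`. This converts the bound on the time
derivative of `H` into an operator norm Lipschitz bound. -/
theorem IsSelfAdjoint.norm_le_of_abs_re_inner_le [CompleteSpace E] {D : E →L[ℂ] E}
    (hD : IsSelfAdjoint D) {c : ℝ} (hc0 : 0 ≤ c)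
    (hc : ∀ x, |(inner ℂ x (D x)).re| ≤ c * ‖x‖ ^ 2) : ‖D‖ ≤ c := by
  refine D.opNorm_le_bound hc0 fun y => ?_
  have h := norm_sesq_le_of_abs_re_le
    (q := (innerₛₗ ℂ : E →ₗ⋆[ℂ] E →ₗ[ℂ] ℂ).compl₂ (D : E →ₗ[ℂ] E))
    (fun x y => by
      simp only [LinearMap.compl₂_apply, innerₛₗ_apply_apply, ContinuousLinearMap.coe_coe]
      rw [inner_conj_symm, hD.inner_comm]) (c := c) (by simpa using hc) (D y) y
  simp only [LinearMap.compl₂_apply, innerₛₗ_apply_apply, ContinuousLinearMap.coe_coe,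
    inner_self_eq_norm_sq_to_K] at h
  rcases eq_or_ne (D y) 0 with h0 | h0
  · rw [h0, norm_zero]; positivity
  · have hpos := norm_pos_iff.mpr h0
    rw [norm_pow, RCLike.norm_ofReal, abs_norm] at h
    refine le_of_mul_le_mul_right (a := ‖D y‖) ?_ hpos
    nlinarith

end SesquilinearForms

/-! ### The bounded model: energy forms and their derivatives -/

section Evolution

variable {E : Type*} [NormedAddCommGroup E] [InnerProductSpace ℂ E]

/-- The quadratic form `w ↦ ⟨w, (1 - ρ²) w⟩` of a self-adjoint operator `ρ`. If `ρ²` is the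
resolvent `(A + 1)⁻¹`, this is the form of `A` at `ρ w`. -/
noncomputable def defectForm (ρ : E →L[ℂ] E) (w : E) : ℝ := ‖w‖ ^ 2 - ‖ρ w‖ ^ 2

/-- The quadratic form `u ↦ ⟨S u, (1 - S) u⟩`. If `S` is the resolvent `(B + 1)⁻¹`, this is the
form of `B` at `S u`. -/
noncomputable def resolventForm (S : E →L[ℂ] E) (u : E) : ℝ := (inner ℂ (S u) (u - S u)).re

theorem continuous_defectForm (ρ : E →L[ℂ] E) : Continuous (defectForm ρ) := by
  unfold defectForm
  fun_prop

theorem defectForm_smul (ρ : E →L[ℂ] E) (c : ℂ) (w : E) :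
    defectForm ρ (c • w) = ‖c‖ ^ 2 * defectForm ρ w := by
  simp only [defectForm, map_smul, norm_smul]
  ring

/-- The bounded reformulation of the evolution problem: `ρ² = (A + 1)⁻¹`, `S = (B + 1)⁻¹`, and
`⟨w, k(t) v⟩` is the value of the form `H(t)` at `(ρ w, ρ v)`. -/
structure IsEvolutionData [CompleteSpace E] (ρ S : E →L[ℂ] E) (k : ℝ → E →L[ℂ] E) (C β : ℝ) :
    Prop where
  selfAdjoint_left : IsSelfAdjoint ρ
  injective_left : Function.Injective ρ
  selfAdjoint_right : IsSelfAdjoint S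
  injective_right : Function.Injective S
  commute : Commute ρ S
  norm_sq_le : ∀ w, ‖ρ w‖ ^ 2 ≤ defectForm ρ w
  resolventForm_nonneg : ∀ u, 0 ≤ resolventForm S u
  pos : 0 < C
  bound_nonneg : 0 ≤ β
  continuous : Continuous k
  lipschitz : ∃ L : ℝ, ∀ s ∈ Ico (0 : ℝ) 1, ∀ t ∈ Ico (0 : ℝ) 1, ‖k s - k t‖ ≤ L * |s - t|
  selfAdjoint : ∀ t ∈ Ico (0 : ℝ) 1, IsSelfAdjoint (k t)
  upper : ∀ t ∈ Ico (0 : ℝ) 1, ∀ w, (inner ℂ w (k t w)).re ≤ C * defectForm ρ w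
  lower : ∀ t ∈ Ico (0 : ℝ) 1, ∀ w u, ρ w = S u →
    C⁻¹ * defectForm ρ w - C * resolventForm S u ≤ (inner ℂ w (k t w)).re
  relative : ∀ w u, ρ w = S u → resolventForm S u ≤ β * defectForm ρ w
  commutator : ∀ t ∈ Ico (0 : ℝ) 1, ∀ w u w', ρ w = S u → ρ w' = u - S u →
    (Complex.I * (inner ℂ w (k t w') - inner ℂ w' (k t w))).re ≤ C * defectForm ρ w
  deriv_le : ∀ t ∈ Ico (0 : ℝ) 1, ∀ w, ∃ d : ℝ,
    HasDerivWithinAt (fun s => (inner ℂ w (k s w)).re) d (Ico 0 1) t ∧ d ≤ C * defectForm ρ w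

/-- Differentiability in time is known only for the quadratic form at a fixed vector, not for `k` in
operator norm. The Lipschitz bound compensates: replacing `w r` by `w t` in the form of `k r - k t`
costs `O(|r - t| ‖w r - w t‖)`, which is `o(|r - t|)`. -/
theorem hasDerivWithinAt_re_inner_apply [CompleteSpace E] {k : ℝ → E →L[ℂ] E} {w : ℝ → E} {w' : E}
    {d L t : ℝ} {s : Set ℝ} (hk : IsSelfAdjoint (k t)) (hL : ∀ r ∈ s, ‖k r - k t‖ ≤ L * |r - t|)
    (hd : HasDerivWithinAt (fun r => (inner ℂ (w t) (k r (w t))).re) d s t)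
    (hw : HasDerivWithinAt w w' s t) :
    HasDerivWithinAt (fun r => (inner ℂ (w r) (k r (w r))).re)
      (d + 2 * (inner ℂ (k t (w t)) w').re) s t := by
  have h1 : HasDerivWithinAt (fun r => (inner ℂ (w r) (k t (w r))).re)
      (2 * (inner ℂ (k t (w t)) w').re) s t := by
    have h2 : HasDerivWithinAt (fun r => k t (w r)) (k t w') s t :=
      ((k t).restrictScalars ℝ).hasFDerivAt.comp_hasDerivWithinAt t hw
    have h3 := Complex.reCLM.hasFDerivAt.comp_hasDerivWithinAt t (hw.inner ℂ h2)
    refine h3.congr_deriv ?_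
    simp only [Complex.reCLM_apply, Complex.add_re]
    rw [← hk.inner_comm, ← inner_conj_symm w', Complex.conj_re]
    ring
  have h4 : HasDerivWithinAt (fun r => (inner ℂ (w r) ((k r - k t) (w r))).re -
      (inner ℂ (w t) ((k r - k t) (w t))).re) 0 s t := by
    rw [hasDerivWithinAt_iff_isLittleO]
    simp only [sub_self, zero_apply, inner_zero_right, smul_zero, sub_zero]
    rw [Asymptotics.isLittleO_iff]
    intro ε hε
    have hc : Tendsto (fun r => L * (‖w r - w t‖ * ‖w r‖ + ‖w t‖ * ‖w r - w t‖)) (𝓝[s] t) (𝓝 0) := by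
      have hwc : Tendsto w (𝓝[s] t) (𝓝 (w t)) := hw.continuousWithinAt
      have h5 : Tendsto (fun r => ‖w r - w t‖) (𝓝[s] t) (𝓝 0) := by
        simpa using (hwc.sub_const (w t)).norm
      simpa using ((h5.mul hwc.norm).add (h5.const_mul ‖w t‖)).const_mul L
    filter_upwards [hc.eventually_lt_const hε, self_mem_nhdsWithin] with r hr hrs
    have h6 : inner ℂ (w r) ((k r - k t) (w r)) - inner ℂ (w t) ((k r - k t) (w t)) =
        inner ℂ (w r - w t) ((k r - k t) (w r)) + inner ℂ (w t) ((k r - k t) (w r - w t)) := by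
      rw [inner_sub_left, map_sub, inner_sub_right]; ring
    have h7 : ∀ x y : E, ‖inner ℂ x ((k r - k t) y)‖ ≤ L * |r - t| * (‖x‖ * ‖y‖) := by
      intro x y
      calc ‖inner ℂ x ((k r - k t) y)‖ ≤ ‖x‖ * ‖(k r - k t) y‖ := norm_inner_le_norm _ _
        _ ≤ ‖x‖ * (L * |r - t| * ‖y‖) := by
          gcongr; exact ContinuousLinearMap.le_of_opNorm_le _ (hL r hrs) y
        _ = _ := by ring
    rw [← Complex.sub_re, h6, Real.norm_eq_abs, Real.norm_eq_abs]
    calc |(inner ℂ (w r - w t) ((k r - k t) (w r)) +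
            inner ℂ (w t) ((k r - k t) (w r - w t))).re|
        ≤ ‖inner ℂ (w r - w t) ((k r - k t) (w r)) +
            inner ℂ (w t) ((k r - k t) (w r - w t))‖ := Complex.abs_re_le_norm _
      _ ≤ _ := norm_add_le _ _
      _ ≤ L * |r - t| * (‖w r - w t‖ * ‖w r‖) + L * |r - t| * (‖w t‖ * ‖w r - w t‖) :=
        add_le_add (h7 _ _) (h7 _ _)
      _ = L * (‖w r - w t‖ * ‖w r‖ + ‖w t‖ * ‖w r - w t‖) * |r - t| := by ring
      _ ≤ ε * |r - t| := by gcongr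
  have h8 := (hd.add h1).add h4
  rw [add_zero] at h8
  have h9 := h8.sub_const (inner ℂ (w t) (k t (w t))).re
  refine h9.congr_of_eventuallyEq (Eventually.of_forall fun r => ?_) ?_
  · simp only [Pi.add_apply, sub_apply, inner_sub_right, Complex.sub_re]
    ring
  · simp

/-- For `S = (B + 1)⁻¹` and `ψ = S u` one has `B ψ = u - S u`, and this is `d/dt ⟨ψ, B ψ⟩ = 2 Re ⟨B
ψ, ψ'⟩`. -/
theorem hasDerivWithinAt_resolventForm [CompleteSpace E] {S : E →L[ℂ] E} (hS : IsSelfAdjoint S)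
    {u : ℝ → E} {u' : E} {s : Set ℝ} {t : ℝ} (hu : HasDerivWithinAt u u' s t) :
    HasDerivWithinAt (fun r => resolventForm S (u r))
      (2 * (inner ℂ (u t - S (u t)) (S u')).re) s t := by
  have h2 : HasDerivWithinAt (fun r => S (u r)) (S u') s t :=
    (S.restrictScalars ℝ).hasFDerivAt.comp_hasDerivWithinAt t hu
  have h3 := Complex.reCLM.hasFDerivAt.comp_hasDerivWithinAt t (h2.inner ℂ (hu.sub h2))
  refine h3.congr_deriv ?_
  simp only [Complex.reCLM_apply, Complex.add_re, Pi.sub_apply]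
  rw [← inner_conj_symm (S u'), Complex.conj_re, inner_sub_right, hS.inner_comm, hS.inner_comm,
    inner_sub_left, hS.inner_comm (u t) (S u')]
  simp only [Complex.sub_re]
  ring

variable [CompleteSpace E] {ρ S : E →L[ℂ] E} {k : ℝ → E →L[ℂ] E} {C β : ℝ}

theorem defectForm_eq (hρ : IsSelfAdjoint ρ) (w : E) :
    defectForm ρ w = (inner ℂ w ((1 - ρ * ρ) w)).re := by
  rw [defectForm, sub_apply, inner_sub_right, Complex.sub_re,
    mul_apply_eq_comp, ← hρ.inner_comm, one_apply_eq_self, inner_self_eq_norm_sq_to_K,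
    inner_self_eq_norm_sq_to_K]
  norm_cast

theorem resolventForm_eq (hS : IsSelfAdjoint S) (u : E) :
    resolventForm S u = (inner ℂ u ((S - S * S) u)).re := by
  rw [resolventForm, hS.inner_comm, map_sub]
  rfl

namespace IsEvolutionData

theorem defectForm_nonneg (D : IsEvolutionData ρ S k C β) (w : E) : 0 ≤ defectForm ρ w :=
  (sq_nonneg _).trans (D.norm_sq_le w)

theorem norm_sq_le_two_mul (D : IsEvolutionData ρ S k C β) (w : E) :
    ‖w‖ ^ 2 ≤ 2 * defectForm ρ w := by
  have h := D.norm_sq_le w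
  unfold defectForm at h ⊢
  linarith

theorem defectForm_apply_le (D : IsEvolutionData ρ S k C β) {J : E →L[ℂ] E} (hJ : Commute ρ J)
    (hJ1 : ‖J‖ ≤ 1) (w : E) : defectForm ρ (J w) ≤ defectForm ρ w := by
  have hρ := D.selfAdjoint_left
  rw [defectForm_eq hρ, defectForm_eq hρ]
  refine re_inner_apply_le_of_commute
    ((IsSelfAdjoint.one _).sub (hρ.mul_self_nonneg.isSelfAdjoint))
    (fun w => defectForm_eq hρ w ▸ D.defectForm_nonneg w) ?_ hJ1 w
  exact (Commute.one_left J).sub_left (hJ.mul_left hJ)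

theorem resolventForm_apply_le (D : IsEvolutionData ρ S k C β) {J : E →L[ℂ] E}
    (hJ : Commute S J) (hJ1 : ‖J‖ ≤ 1) (u : E) : resolventForm S (J u) ≤ resolventForm S u := by
  have hS := D.selfAdjoint_right
  rw [resolventForm_eq hS, resolventForm_eq hS]
  refine re_inner_apply_le_of_commute (hS.sub (hS.mul_self_nonneg.isSelfAdjoint))
    (fun w => resolventForm_eq hS w ▸ D.resolventForm_nonneg w) ?_ hJ1 u
  exact hJ.sub_left (hJ.mul_left hJ)

end IsEvolutionData

end Evolution

/-! ### The regularized evolution and its uniform energy estimate -/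

section Evolution

variable {E : Type*} [NormedAddCommGroup E] [InnerProductSpace ℂ E] [CompleteSpace E]
  {ρ S : E →L[ℂ] E} {k : ℝ → E →L[ℂ] E} {C β : ℝ}

namespace IsEvolutionData

/-- The evolution generated by the regularized Hamiltonian `N k(t) N`, with its energy bound. -/
theorem exists_regularized (D : IsEvolutionData ρ S k C β) {M N : E →L[ℂ] E} (hSM : S * M = N)
    (hN : IsSelfAdjoint N) (hρN : Commute ρ N) (hSN : Commute S N) (h1 : ‖ρ * N‖ ≤ 1) (w₀ : E) :
    ∃ w : ℝ → E, w 0 = (ρ * N) ((ρ * N) w₀) ∧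
      (∀ y, ∀ t ∈ Icc (0 : ℝ) 1, HasDerivWithinAt (fun s => inner ℂ (ρ (ρ y)) (w s))
        (-Complex.I * inner ℂ ((ρ * N) ((ρ * N) y)) (k t (w t))) (Icc 0 1) t) ∧
      ∀ t ∈ Ico (0 : ℝ) 1, defectForm ρ (w t) ≤
        C * (C + C * β) * Real.exp ((C ^ 2 + C ^ 3) * t) * defectForm ρ w₀ := by
  have hρ := D.selfAdjoint_left
  have hS := D.selfAdjoint_right
  have hC := D.pos
  have eSM : ∀ x, S (M x) = N x := fun x => congrArg (fun T : E →L[ℂ] E => T x) hSM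
  have eρN : ∀ x, ρ (N x) = N (ρ x) := fun x => congrArg (fun T : E →L[ℂ] E => T x) hρN.eq
  have eSN : ∀ x, S (N x) = N (S x) := fun x => congrArg (fun T : E →L[ℂ] E => T x) hSN.eq
  have eρS : ∀ x, ρ (S x) = S (ρ x) := fun x => congrArg (fun T : E →L[ℂ] E => T x) D.commute.eq
  -- The regularized state is `ψ = S u`, which solves `i ψ' = N k N ψ` because `S * M = N`. Solving
  -- for `u` keeps `ψ` in the domain of `B`, with `B ψ = u - S u`. The function returned is `w = N
  -- ψ`, so that `ρ w = J ψ` for `J = ρ * N`; the initial value makes `ψ(0) = J (ρ w₀)`.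
  obtain ⟨u, hu0, hu⟩ := exists_linear_ode_solution
    (L := fun t => (-Complex.I) • (M * (k t * (N * S))))
    (by have := D.continuous; fun_prop) (ρ (M (ρ w₀)))
  have hSu0 : S (u 0) = ρ (N (ρ w₀)) := by rw [hu0, ← eρS, eSM]
  have hu' : ∀ t ∈ Icc (0 : ℝ) 1,
      HasDerivWithinAt u (-Complex.I • M (k t (N (S (u t))))) (Icc 0 1) t := hu
  have hw : ∀ t ∈ Icc (0 : ℝ) 1, HasDerivWithinAt (fun s => N (S (u s)))
      (-Complex.I • N (N (k t (N (S (u t)))))) (Icc 0 1) t := fun t ht => by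
    have h := ((N * S).restrictScalars ℝ).hasFDerivAt.comp_hasDerivWithinAt t (hu' t ht)
    refine h.congr_deriv ?_
    simp only [ContinuousLinearMap.coe_restrictScalars', mul_apply_eq_comp, map_smul, eSM]
  have hw0 : N (S (u 0)) = (ρ * N) ((ρ * N) w₀) := by
    simp only [mul_apply_eq_comp, hSu0, eρN]
  refine ⟨fun s => N (S (u s)), hw0, fun y t ht => ?_, fun t ht => ?_⟩
  · have h := (hasDerivWithinAt_const t (Icc (0 : ℝ) 1) (ρ (ρ y))).inner ℂ (hw t ht)
    refine h.congr_deriv ?_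
    simp only [mul_apply_eq_comp]
    rw [inner_zero_left, add_zero, inner_smul_right, ← hN.inner_comm, ← hN.inner_comm, ← eρN,
      ← eρN, eρN y]
  · have hJρ : Commute ρ (ρ * N) := (Commute.refl ρ).mul_right hρN
    have hJS : Commute S (ρ * N) := D.commute.symm.mul_right hSN
    obtain ⟨L, hL⟩ := D.lipschitz
    -- The form of `B` is taken at `ψ` rather than at `J ψ`, so that its derivative is exactly the
    -- commutator evaluated at `J ψ`. The lower bound survives because the form of `B` at `J ψ` is
    -- no larger.
    set F : ℝ → ℝ := fun s => (inner ℂ (N (S (u s))) (k s (N (S (u s))))).re +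
      C * resolventForm S (u s) with hF
    have hlow : ∀ s ∈ Ico (0 : ℝ) 1, defectForm ρ (N (S (u s))) ≤ C * F s := by
      intro s hs
      have h2 := D.lower s hs (N (S (u s))) ((ρ * N) (u s)) (by
        simp only [mul_apply_eq_comp]; rw [← eSN, eρS])
      have h3 := D.resolventForm_apply_le hJS h1 (u s)
      have h4 : C⁻¹ * defectForm ρ (N (S (u s))) ≤ F s := by
        have := mul_le_mul_of_nonneg_left h3 hC.le
        simp only [hF]
        linarith
      rwa [inv_mul_le_iff₀ hC] at h4
    have hder : ∀ s ∈ Ico (0 : ℝ) 1, ∃ F' : ℝ, HasDerivWithinAt F F' (Ico 0 1) s ∧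
        F' ≤ (C ^ 2 + C ^ 3) * F s := by
      intro s hs
      have hsI := Ico_subset_Icc_self hs
      set w := N (S (u s)) with hwdef
      obtain ⟨d, hd, hdle⟩ := D.deriv_le s hs w
      have h2 := hasDerivWithinAt_re_inner_apply (D.selfAdjoint s hs)
        (fun r hr => hL r hr s hs) hd ((hw s hsI).mono Ico_subset_Icc_self)
      have h3 := (hasDerivWithinAt_resolventForm hS ((hu' s hsI).mono Ico_subset_Icc_self)).const_mul
        C
      refine ⟨_, h2.add h3, ?_⟩
      -- The regularized flow conserves its own energy: the inner product is `-i ‖N k w‖²`, which is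
      -- purely imaginary.
      have h4 : (inner ℂ (k s w) (-Complex.I • N (N (k s w)))).re = 0 := by
        rw [inner_smul_right, ← hN.inner_comm, inner_self_eq_norm_sq_to_K]
        simp [← Complex.ofReal_pow]
      -- The vectors `w` and `N (u - S u)` represent `J ψ` and `B J ψ`, both in `Q(A)`, so the
      -- commutator hypothesis is available.
      have h5 := D.commutator s hs w ((ρ * N) (u s)) (N (u s - S (u s)))
        (by simp only [mul_apply_eq_comp]; rw [hwdef, ← eSN, eρS])
        (by simp only [mul_apply_eq_comp]; rw [map_sub, map_sub, ← eSN, eρS])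
      have h6 : 2 * (inner ℂ (u s - S (u s)) (S (-Complex.I • M (k s w)))).re =
          (Complex.I * (inner ℂ w (k s (N (u s - S (u s)))) -
            inner ℂ (N (u s - S (u s))) (k s w))).re := by
        rw [map_smul, eSM, inner_smul_right, ← hN.inner_comm, ← (D.selfAdjoint s hs).inner_comm w,
          ← inner_conj_symm (k s w)]
        simp only [Complex.mul_re, Complex.neg_re, Complex.neg_im, Complex.I_re, Complex.I_im,
          Complex.sub_re, Complex.sub_im, Complex.conj_re, Complex.conj_im]
        ring
      have h7 := hlow s hs
      rw [h4, h6]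
      calc d + 2 * 0 + C * _ ≤ C * defectForm ρ w + 2 * 0 + C * (C * defectForm ρ w) := by gcongr
        _ = (C + C ^ 2) * defectForm ρ w := by ring
        _ ≤ (C + C ^ 2) * (C * F s) := by gcongr
        _ = (C ^ 2 + C ^ 3) * F s := by ring
    choose! F' hF' hF'le using hder
    have hFc : ContinuousOn F (Ico 0 1) := fun s hs => (hF' s hs).continuousWithinAt
    have hF0 : F 0 ≤ (C + C * β) * defectForm ρ w₀ := by
      have h2 := D.upper 0 (by simp) (N (S (u 0)))
      have h3 : resolventForm S (u 0) ≤ β * defectForm ρ ((ρ * N) w₀) := by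
        refine D.relative _ _ ?_
        simp only [mul_apply_eq_comp]
        rw [hSu0, eρN]
      have h4 := D.defectForm_apply_le hJρ h1 w₀
      have h5 := D.defectForm_apply_le hJρ h1 ((ρ * N) w₀)
      rw [← hw0] at h5
      have h6 : resolventForm S (u 0) ≤ β * defectForm ρ w₀ :=
        h3.trans (mul_le_mul_of_nonneg_left h4 D.bound_nonneg)
      calc F 0 ≤ C * defectForm ρ w₀ + C * (β * defectForm ρ w₀) :=
            add_le_add (h2.trans (mul_le_mul_of_nonneg_left (h5.trans h4) hC.le))
              (mul_le_mul_of_nonneg_left h6 hC.le)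
        _ = _ := by ring
    have hsub : Icc 0 t ⊆ Ico (0 : ℝ) 1 := fun s hs => ⟨hs.1, hs.2.trans_lt ht.2⟩
    have hgr := le_gronwallBound_of_liminf_deriv_right_le (f := F) (f' := F')
      (δ := (C + C * β) * defectForm ρ w₀) (K := C ^ 2 + C ^ 3) (ε := 0) (hFc.mono hsub)
      (fun s hs r hr => by
        have hs' : s ∈ Ico (0 : ℝ) 1 := hsub (Ico_subset_Icc_self hs)
        exact ((hF' s hs').mono_of_mem_nhdsWithin
          (Ico_mem_nhdsGE_of_mem hs')).liminf_right_slope_le hr) hF0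
      (fun s hs => by rw [add_zero]; exact hF'le s (hsub (Ico_subset_Icc_self hs)))
      t (right_mem_Icc.mpr ht.1)
    rw [gronwallBound_ε0, sub_zero] at hgr
    calc defectForm ρ (N (S (u t))) ≤ C * F t := hlow t ht
      _ ≤ C * ((C + C * β) * defectForm ρ w₀ * Real.exp ((C ^ 2 + C ^ 3) * t)) := by gcongr
      _ = _ := by ring

theorem injective_sq (D : IsEvolutionData ρ S k C β) : Function.Injective (ρ * ρ) :=
  D.injective_left.comp D.injective_left

theorem selfAdjoint_sq (D : IsEvolutionData ρ S k C β) : IsSelfAdjoint (ρ * ρ) :=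
  D.selfAdjoint_left.mul_self_nonneg.isSelfAdjoint

/-- The bounded regularizing operators, converging strongly to the identity. -/
theorem exists_regularizers (D : IsEvolutionData ρ S k C β) :
    ∃ M N : ℕ → E →L[ℂ] E, (∀ n, S * M n = N n) ∧ (∀ n, IsSelfAdjoint (N n)) ∧
      (∀ n, Commute ρ (N n)) ∧ (∀ n, Commute S (N n)) ∧ (∀ n, ‖ρ * N n‖ ≤ 1) ∧
      ∀ v, Tendsto (fun n => (ρ * N n) v) atTop (𝓝 v) := by
  obtain ⟨G, hG, hG1, hGc, hGt⟩ := exists_approxIdentity D.selfAdjoint_sq D.injective_sq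
  obtain ⟨G', hG', hG'1, hG'c, hG't⟩ := exists_approxIdentity D.selfAdjoint_right D.injective_right
  have hRρ : Commute (ρ * ρ) ρ := (Commute.refl ρ).mul_left (Commute.refl ρ)
  have hRS : Commute (ρ * ρ) S := D.commute.mul_left D.commute
  have c1 : ∀ n, Commute (G n) ρ := fun n => hGc n _ hRρ
  have c2 : ∀ n, Commute (G n) S := fun n => hGc n _ hRS
  have c3 : ∀ n, Commute (G' n) ρ := fun n => hG'c n _ D.commute.symm
  have c4 : ∀ n, Commute (G' n) S := fun n => hG'c n _ (Commute.refl S)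
  have c5 : ∀ n, Commute (G' n) (G n) := fun n => hG'c n _ (c2 n).symm
  have hM : ∀ n, Commute ρ (ρ * (G n * G' n)) := fun n =>
    (Commute.refl ρ).mul_right ((c1 n).symm.mul_right (c3 n).symm)
  have hM' : ∀ n, Commute S (ρ * (G n * G' n)) := fun n =>
    D.commute.symm.mul_right ((c2 n).symm.mul_right (c4 n).symm)
  have hMs : ∀ n, IsSelfAdjoint (ρ * (G n * G' n)) := fun n => by
    have h1 : IsSelfAdjoint (G n * G' n) := (IsSelfAdjoint.commute_iff (hG n) (hG' n)).mp (c5 n).symm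
    exact (IsSelfAdjoint.commute_iff D.selfAdjoint_left h1).mp
      ((c1 n).symm.mul_right (c3 n).symm)
  -- With `M = ρ G G'` and `N = S M`, the product `ρ N` is the approximate identity built from `ρ²`
  -- times the one built from `S`.
  have hJ : ∀ n, ρ * (S * (ρ * (G n * G' n))) = (ρ * ρ * G n) * (S * G' n) := fun n => by
    calc ρ * (S * (ρ * (G n * G' n))) = ρ * (S * ρ) * (G n * G' n) := by simp only [mul_assoc]
      _ = ρ * (ρ * S) * (G n * G' n) := by rw [D.commute.eq]
      _ = ρ * ρ * (S * G n) * G' n := by simp only [mul_assoc]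
      _ = ρ * ρ * (G n * S) * G' n := by rw [(c2 n).eq]
      _ = _ := by simp only [mul_assoc]
  refine ⟨fun n => ρ * (G n * G' n), fun n => S * (ρ * (G n * G' n)), fun n => rfl, fun n => ?_,
    fun n => D.commute.mul_right (hM n), fun n => (Commute.refl S).mul_right (hM' n), fun n => ?_,
    fun v => ?_⟩
  · exact (IsSelfAdjoint.commute_iff D.selfAdjoint_right (hMs n)).mp (hM' n)
  · rw [hJ]
    exact (norm_mul_le _ _).trans (mul_le_one₀ (hG1 n) (norm_nonneg _) (hG'1 n))
  · simp only [hJ]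
    have h1 : Tendsto (fun n => (ρ * ρ * G n) ((S * G' n) v - v)) atTop (𝓝 0) := by
      have h2 : Tendsto (fun n => ‖(S * G' n) v - v‖) atTop (𝓝 0) := by
        simpa using ((hG't v).sub_const v).norm
      refine squeeze_zero_norm (fun n => ?_) h2
      simpa using ContinuousLinearMap.le_of_opNorm_le _ (hG1 n) ((S * G' n) v - v)
    have h3 := h1.add (hGt v)
    rw [zero_add] at h3
    refine h3.congr fun n => ?_
    rw [map_sub]
    simp only [mul_apply_eq_comp, sub_add_cancel]

end IsEvolutionData

end Evolution

/-! ### Weak evolutions: norm conservation, uniqueness and removal of the regularization -/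

section Evolution

variable {E : Type*} [NormedAddCommGroup E] [InnerProductSpace ℂ E]
  {ρ S : E →L[ℂ] E} {k : ℝ → E →L[ℂ] E} {C β : ℝ}

theorem re_inner_self_eq (x : E) : (inner ℂ x x).re = ‖x‖ ^ 2 :=
  inner_self_eq_norm_sq (𝕜 := ℂ) x

/-- For a bounded family, testing on `v` is a uniform limit of tests on vectors from a dense set. -/
theorem continuousOn_inner_of_dense {Q : E →L[ℂ] E} (hQ : DenseRange Q) {w : ℝ → E} {s : Set ℝ}
    {M : ℝ} (hM : ∀ t ∈ s, ‖w t‖ ≤ M) (hw : ∀ y, ContinuousOn (fun t => inner ℂ (Q y) (w t)) s)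
    (v : E) : ContinuousOn (fun t => inner ℂ v (w t)) s := by
  refine continuousOn_of_uniform_approx_of_continuousOn fun u hu => ?_
  obtain ⟨ε, hε, hεu⟩ := Metric.mem_uniformity_dist.mp hu
  obtain ⟨y, hy⟩ := hQ.exists_dist_lt v (ε := ε / (|M| + 1)) (by positivity)
  refine ⟨_, hw y, fun t ht => hεu ?_⟩
  rw [dist_eq_norm, ← inner_sub_left]
  rw [dist_eq_norm, lt_div_iff₀ (by positivity)] at hy
  calc ‖inner ℂ (v - Q y) (w t)‖ ≤ ‖v - Q y‖ * ‖w t‖ := norm_inner_le_norm _ _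
    _ ≤ ‖v - Q y‖ * (|M| + 1) := by
      gcongr
      linarith [hM t ht, le_abs_self M]
    _ < ε := hy

/-- Weak solutions of `i d/dt (ρ² w) = k(t) w`. -/
structure IsWeakEvolution (ρ : E →L[ℂ] E) (k : ℝ → E →L[ℂ] E) (w : ℝ → E) : Prop where
  continuousOn : ContinuousOn (fun t => ρ (w t)) (Ico 0 1)
  hasDerivAt : ∀ y, ∀ t ∈ Ioo (0 : ℝ) 1,
    HasDerivAt (fun s => inner ℂ (ρ (ρ y)) (w s)) (-Complex.I * inner ℂ y (k t (w t))) t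

namespace IsWeakEvolution

theorem sub {w w' : ℝ → E} (h : IsWeakEvolution ρ k w) (h' : IsWeakEvolution ρ k w') :
    IsWeakEvolution ρ k fun t => w t - w' t where
  continuousOn := by
    simp only [map_sub]
    exact h.continuousOn.sub h'.continuousOn
  hasDerivAt y t ht := by
    simp only [map_sub, inner_sub_right, mul_sub]
    exact (h.hasDerivAt y t ht).sub (h'.hasDerivAt y t ht)

end IsWeakEvolution

variable [CompleteSpace E]

/-- Expand `0 ≤ q (w' - w i)` for the positive form `q = defectForm ρ`: apart from `q (w i) ≤ b`,
only terms linear in `w i` remain, and these pass to the weak limit. -/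
theorem defectForm_le_of_weak_limit {ι : Type*} {l : Filter ι} [l.NeBot] (hρ : IsSelfAdjoint ρ)
    (hpos : ∀ w, 0 ≤ defectForm ρ w) {w : ι → E} {w' : E} {b : ℝ}
    (hw : ∀ v, Tendsto (fun i => inner ℂ v (w i)) l (𝓝 (inner ℂ v w')))
    (hb : ∀ i, defectForm ρ (w i) ≤ b) : defectForm ρ w' ≤ b := by
  have h1 : ∀ i, 2 * ((inner ℂ w' (w i)).re - (inner ℂ (ρ (ρ w')) (w i)).re) ≤
      defectForm ρ w' + b := by
    intro i
    have h2 := hpos (w' - w i)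
    have h3 := hb i
    unfold defectForm at h2 h3 ⊢
    rw [map_sub, norm_sub_sq (𝕜 := ℂ), norm_sub_sq (𝕜 := ℂ), ← hρ.inner_comm] at h2
    simp only [RCLike.re_to_complex] at h2
    linarith
  have h4 : Tendsto (fun i => 2 * ((inner ℂ w' (w i)).re - (inner ℂ (ρ (ρ w')) (w i)).re)) l
      (𝓝 (2 * ((inner ℂ w' w').re - (inner ℂ (ρ (ρ w')) w').re))) :=
    (((Complex.continuous_re.tendsto _).comp (hw w')).sub
      ((Complex.continuous_re.tendsto _).comp (hw _))).const_mul 2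
  have h5 := le_of_tendsto h4 (Eventually.of_forall h1)
  rw [hρ.inner_comm, re_inner_self_eq, re_inner_self_eq] at h5
  unfold defectForm at h5 ⊢
  linarith

/-- Self-adjointness moves `k t` onto the fixed vector `y`, where it is norm continuous; pairing
with a bounded, weakly continuous `w` is then continuous. -/
theorem continuousOn_inner_apply {w : ℝ → E} {s : Set ℝ} {M : ℝ} (hM : ∀ t ∈ s, ‖w t‖ ≤ M)
    (hw : ∀ v, ContinuousOn (fun t => inner ℂ v (w t)) s) (hk : Continuous k)
    (hsa : ∀ t ∈ s, IsSelfAdjoint (k t)) (y : E) :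
    ContinuousOn (fun t => inner ℂ y (k t (w t))) s := by
  intro t ht
  have h1 : Tendsto (fun r => inner ℂ (k r y - k t y) (w r)) (𝓝[s] t) (𝓝 0) := by
    have h2 : Tendsto (fun r => ‖k r y - k t y‖ * M) (𝓝[s] t) (𝓝 0) := by
      have h3 : Tendsto (fun r => k r y) (𝓝 t) (𝓝 (k t y)) :=
        (hk.clm_apply continuous_const).tendsto t
      simpa using ((h3.mono_left nhdsWithin_le_nhds).sub_const (k t y)).norm.mul_const M
    refine squeeze_zero_norm' ?_ h2
    filter_upwards [self_mem_nhdsWithin] with r hr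
    exact (norm_inner_le_norm _ _).trans (mul_le_mul_of_nonneg_left (hM r hr) (norm_nonneg _))
  have h4 := h1.add (hw (k t y) t ht)
  rw [zero_add] at h4
  change Tendsto _ _ (𝓝 (inner ℂ y (k t (w t))))
  rw [← (hsa t ht).inner_comm]
  refine h4.congr' ?_
  filter_upwards [self_mem_nhdsWithin] with r hr
  rw [← (hsa r hr).inner_comm, inner_sub_left, sub_add_cancel]

namespace IsWeakEvolution

/-- Conservation of the norm. -/
theorem norm_eq {w : ℝ → E} (hw : IsWeakEvolution ρ k w) (hρ : IsSelfAdjoint ρ)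
    (hsa : ∀ t ∈ Ico (0 : ℝ) 1, IsSelfAdjoint (k t)) {t : ℝ} (ht : t ∈ Ico (0 : ℝ) 1) :
    ‖ρ (w t)‖ = ‖ρ (w 0)‖ := by
  have hc : ContinuousOn (fun t => ‖ρ (w t)‖ ^ 2) (Ico 0 1) := hw.continuousOn.norm.pow 2
  have key : ∀ a ∈ Ioo (0 : ℝ) 1, ∀ b ∈ Ioo (0 : ℝ) 1, a ≤ b →
      ‖ρ (w a)‖ ^ 2 = ‖ρ (w b)‖ ^ 2 := by
    intro a ha b hb hab
    have hsub : Icc a b ⊆ Ioo 0 1 := fun s hs => ⟨ha.1.trans_le hs.1, hs.2.trans_lt hb.2⟩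
    refine eq_of_lower_support (f := fun t => ‖ρ (w t)‖ ^ 2) hab
      (hc.mono (hsub.trans Ioo_subset_Ico_self)) fun t ht => ?_
    -- The support function comes from `‖ρ (w t) - ρ (w s)‖² ≥ 0`. Its derivative at `t` is the real
    -- part of `-2 i ⟨w, k w⟩`, which vanishes because `k t` is self-adjoint.
    refine ⟨fun s => 2 * (inner ℂ (ρ (ρ (w t))) (w s)).re - ‖ρ (w t)‖ ^ 2, ?_, ?_, fun s => ?_⟩
    · have h1 := Complex.reCLM.hasFDerivAt.comp_hasDerivAt t (hw.hasDerivAt (w t) t (hsub ht))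
      refine ((h1.const_mul 2).sub_const _).congr_deriv ?_
      have h2 : (inner ℂ (w t) (k t (w t))).im = 0 := by
        rw [← Complex.conj_eq_iff_im, inner_conj_symm,
          (hsa t (Ioo_subset_Ico_self (hsub ht))).inner_comm]
      simp [h2]
    · simp only [hρ.inner_comm (ρ (w t)), re_inner_self_eq]
      ring
    · have h3 := sq_nonneg ‖ρ (w t) - ρ (w s)‖
      rw [norm_sub_sq (𝕜 := ℂ), RCLike.re_to_complex] at h3
      simp only [hρ.inner_comm (ρ (w t))]
      linarith
  rcases ht.1.eq_or_lt with rfl | h0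
  · rfl
  -- The equation holds only in the open interval, so time `0` is reached by continuity.
  have hlim : Tendsto (fun s => ‖ρ (w s)‖ ^ 2) (𝓝[>] 0) (𝓝 (‖ρ (w 0)‖ ^ 2)) := by
    refine Tendsto.mono_left (hc 0 (by simp)) ?_
    rw [nhdsWithin_le_iff]
    filter_upwards [Ioo_mem_nhdsGT (zero_lt_one' ℝ)] with s hs using Ioo_subset_Ico_self hs
  have hev : (fun s => ‖ρ (w s)‖ ^ 2) =ᶠ[𝓝[>] 0] fun _ => ‖ρ (w t)‖ ^ 2 := by
    filter_upwards [Ioo_mem_nhdsGT h0] with s hs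
    exact key s ⟨hs.1, hs.2.trans ht.2⟩ t ⟨h0, ht.2⟩ hs.2.le
  have h4 := tendsto_nhds_unique (hlim.congr' hev) tendsto_const_nhds
  rw [← Real.sqrt_sq (norm_nonneg (ρ (w t))), ← Real.sqrt_sq (norm_nonneg (ρ (w 0))), h4]

/-- Uniqueness of weak solutions. -/
theorem eq_of_initial {w w' : ℝ → E} (h : IsWeakEvolution ρ k w) (h' : IsWeakEvolution ρ k w')
    (hρ : IsSelfAdjoint ρ) (hsa : ∀ t ∈ Ico (0 : ℝ) 1, IsSelfAdjoint (k t))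
    (h0 : ρ (w 0) = ρ (w' 0)) {t : ℝ} (ht : t ∈ Ico (0 : ℝ) 1) : ρ (w t) = ρ (w' t) := by
  have h1 := (h.sub h').norm_eq hρ hsa ht
  rwa [map_sub, map_sub, h0, sub_self, norm_zero, norm_eq_zero, sub_eq_zero] at h1

end IsWeakEvolution

/-- Interpolation between boundedness in `Q(A)` and Lipschitz continuity in `Q(A)*`: testing on `y =
w s - w t` gives `‖ρ (w s - w t)‖² = O(|s - t|)`. -/
theorem continuousOn_of_weak_hasDerivWithinAt (hρ : IsSelfAdjoint ρ) {w : ℝ → E} {M Λ : ℝ}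
    (hM : ∀ t ∈ Ico (0 : ℝ) 1, ‖w t‖ ≤ M) (hΛ : ∀ t ∈ Ico (0 : ℝ) 1, ‖k t‖ ≤ Λ)
    (hw : ∀ y, ∀ t ∈ Ico (0 : ℝ) 1, HasDerivWithinAt (fun s => inner ℂ (ρ (ρ y)) (w s))
      (-Complex.I * inner ℂ y (k t (w t))) (Ico 0 1) t) :
    ContinuousOn (fun t => ρ (w t)) (Ico 0 1) := by
  have h0 : (0 : ℝ) ∈ Ico (0 : ℝ) 1 := by simp
  have hM0 : 0 ≤ M := (norm_nonneg _).trans (hM 0 h0)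
  have hΛ0 : 0 ≤ Λ := (norm_nonneg _).trans (hΛ 0 h0)
  have key : ∀ s ∈ Ico (0 : ℝ) 1, ∀ t ∈ Ico (0 : ℝ) 1,
      ‖ρ (w s) - ρ (w t)‖ ^ 2 ≤ 2 * M * Λ * M * ‖s - t‖ := by
    intro s hs t ht
    have h1 : ‖w s - w t‖ ≤ 2 * M := (norm_sub_le _ _).trans (by linarith [hM s hs, hM t ht])
    have h2 := (convex_Ico (0 : ℝ) 1).norm_image_sub_le_of_norm_hasDerivWithin_le
      (hw (w s - w t)) (C := 2 * M * Λ * M) (fun r hr => by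
        rw [norm_mul, norm_neg, Complex.norm_I, one_mul]
        calc ‖inner ℂ (w s - w t) (k r (w r))‖ ≤ ‖w s - w t‖ * ‖k r (w r)‖ :=
              norm_inner_le_norm _ _
          _ ≤ 2 * M * (Λ * M) := by
            gcongr
            exact ((k r).le_of_opNorm_le (hΛ r hr) _).trans (by gcongr; exact hM r hr)
          _ = _ := by ring) ht hs
    rw [← inner_sub_right, hρ.inner_comm, map_sub ρ (w s) (w t)] at h2
    rwa [inner_self_eq_norm_sq_to_K, norm_pow, RCLike.norm_ofReal, abs_norm] at h2
  intro t ht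
  rw [ContinuousWithinAt, tendsto_iff_norm_sub_tendsto_zero]
  have h3 : Tendsto (fun s => √(2 * M * Λ * M * ‖s - t‖)) (𝓝[Ico 0 1] t) (𝓝 0) := by
    have h4 : Continuous fun s : ℝ => √(2 * M * Λ * M * ‖s - t‖) := by fun_prop
    have := h4.tendsto t
    simp only [sub_self, norm_zero, mul_zero, Real.sqrt_zero] at this
    exact this.mono_left nhdsWithin_le_nhds
  refine squeeze_zero' (Eventually.of_forall fun _ => norm_nonneg _) ?_ h3
  filter_upwards [self_mem_nhdsWithin] with s hs
  exact Real.le_sqrt_of_sq_le (key s hs t ht)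

namespace IsEvolutionData

/-- Existence of weak solutions together with the energy bound. -/
theorem exists_weak_solution (D : IsEvolutionData ρ S k C β) (w₀ : E) :
    ∃ w : ℝ → E, w 0 = w₀ ∧
      (∀ t ∈ Ico (0 : ℝ) 1, defectForm ρ (w t) ≤
        C * (C + C * β) * Real.exp ((C ^ 2 + C ^ 3) * t) * defectForm ρ w₀) ∧
      ∀ y, ∀ t ∈ Ico (0 : ℝ) 1, HasDerivWithinAt (fun s => inner ℂ (ρ (ρ y)) (w s))
        (-Complex.I * inner ℂ y (k t (w t))) (Ico 0 1) t := by
  have hρ := D.selfAdjoint_left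
  have hC := D.pos
  have hβ := D.bound_nonneg
  have hd0 := D.defectForm_nonneg w₀
  obtain ⟨Mop, N, hSM, hN, hρN, hSN, hJ1, hJ⟩ := D.exists_regularizers
  choose W hW0 hWd hWb using fun n =>
    D.exists_regularized (hSM n) (hN n) (hρN n) (hSN n) (hJ1 n) w₀
  set b : ℝ → ℝ := fun t =>
    C * (C + C * β) * Real.exp ((C ^ 2 + C ^ 3) * t) * defectForm ρ w₀ with hb
  set M : ℝ := √(2 * b 1) with hMdef
  have hM0 : 0 ≤ M := Real.sqrt_nonneg _
  have hM : ∀ n, ∀ t ∈ Ico (0 : ℝ) 1, ‖W n t‖ ≤ M := by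
    intro n t ht
    refine Real.le_sqrt_of_sq_le ((D.norm_sq_le_two_mul _).trans ?_)
    refine mul_le_mul_of_nonneg_left ((hWb n t ht).trans ?_) zero_le_two
    simp only [hb]
    gcongr
    exact ht.2.le
  obtain ⟨Λ, hΛ⟩ := (isCompact_Icc (a := (0 : ℝ)) (b := 1)).exists_bound_of_continuousOn
    D.continuous.continuousOn
  have hΛ' : ∀ t ∈ Ico (0 : ℝ) 1, ‖k t‖ ≤ Λ := fun t ht => hΛ t (Ico_subset_Icc_self ht)
  have hΛ0 : 0 ≤ Λ := (norm_nonneg _).trans (hΛ 0 (by simp))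
  -- One nonprincipal ultrafilter yields weak limits at all times simultaneously, without a diagonal
  -- subsequence.
  let U : Ultrafilter ℕ := hyperfilter ℕ
  have hU : (U : Filter ℕ) ≤ atTop := Nat.hyperfilter_le_atTop
  have hlim : ∀ t, ∃ w' : E, t ∈ Ico (0 : ℝ) 1 →
      ∀ v, Tendsto (fun n => inner ℂ v (W n t)) U (𝓝 (inner ℂ v w')) := by
    intro t
    by_cases ht : t ∈ Ico (0 : ℝ) 1
    · obtain ⟨w', _, hw'⟩ := exists_weak_limit U (Eventually.of_forall fun n => hM n t ht)
      exact ⟨w', fun _ => hw'⟩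
    · exact ⟨0, fun h => absurd h ht⟩
  choose w hw using hlim
  have hJJ1 : ∀ n y, ‖(ρ * N n) ((ρ * N n) y)‖ ≤ ‖y‖ := fun n y => by
    have h1 := ContinuousLinearMap.le_of_opNorm_le _ (hJ1 n) y
    have h2 := ContinuousLinearMap.le_of_opNorm_le _ (hJ1 n) ((ρ * N n) y)
    rw [one_mul] at h1 h2
    exact h2.trans h1
  have hJJ : ∀ y, Tendsto (fun n => (ρ * N n) ((ρ * N n) y)) atTop (𝓝 y) := fun y => by
    have h1 : Tendsto (fun n => (ρ * N n) ((ρ * N n) y - y)) atTop (𝓝 0) := by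
      have h2 : Tendsto (fun n => ‖(ρ * N n) y - y‖) atTop (𝓝 0) := by
        simpa using ((hJ y).sub_const y).norm
      refine squeeze_zero_norm (fun n => ?_) h2
      simpa using ContinuousLinearMap.le_of_opNorm_le _ (hJ1 n) ((ρ * N n) y - y)
    have h3 := h1.add (hJ y)
    rw [zero_add] at h3
    refine h3.congr fun n => ?_
    rw [map_sub, sub_add_cancel]
  have hkW : ∀ n, ∀ t ∈ Ico (0 : ℝ) 1, ‖k t (W n t)‖ ≤ Λ * M := fun n t ht =>
    ((k t).le_of_opNorm_le (hΛ' t ht) _).trans (by gcongr; exact hM n t ht)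
  -- Tests on the dense range of `ρ²` have derivatives bounded uniformly in `n`; the uniform bound
  -- on `W n` extends the equicontinuity to all `v`.
  have hequi : ∀ v : E, ∀ ε > 0, ∃ δ > 0, ∀ n, ∀ s ∈ Ico (0 : ℝ) 1, ∀ t ∈ Ico (0 : ℝ) 1,
      |s - t| < δ → ‖inner ℂ v (W n s - W n t)‖ ≤ ε := by
    intro v ε hε
    obtain ⟨y, hy⟩ := (D.selfAdjoint_sq.denseRange_of_injective D.injective_sq).exists_dist_lt v
      (ε := ε / 2 / (2 * M + 1)) (by positivity)
    rw [dist_eq_norm, lt_div_iff₀ (by positivity), mul_apply_eq_comp] at hy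
    refine ⟨ε / 2 / (‖y‖ * (Λ * M) + 1), by positivity, fun n s hs t ht hst => ?_⟩
    have h1 := (convex_Ico (0 : ℝ) 1).norm_image_sub_le_of_norm_hasDerivWithin_le
      (C := ‖y‖ * (Λ * M))
      (fun r hr => (hWd n y r (Ico_subset_Icc_self hr)).mono Ico_subset_Icc_self)
      (fun r hr => by
        rw [norm_mul, norm_neg, Complex.norm_I, one_mul]
        exact (norm_inner_le_norm _ _).trans
          (mul_le_mul (hJJ1 n y) (hkW n r hr) (norm_nonneg _) (norm_nonneg _))) ht hs
    rw [← inner_sub_right, Real.norm_eq_abs] at h1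
    have h2 : ‖inner ℂ (v - ρ (ρ y)) (W n s - W n t)‖ ≤ ‖v - ρ (ρ y)‖ * (2 * M + 1) := by
      refine (norm_inner_le_norm _ _).trans ?_
      gcongr
      exact (norm_sub_le _ _).trans (by linarith [hM n s hs, hM n t ht])
    have h3 : ‖y‖ * (Λ * M) * |s - t| ≤ ε / 2 := by
      rw [lt_div_iff₀ (by positivity)] at hst
      nlinarith [abs_nonneg (s - t)]
    calc ‖inner ℂ v (W n s - W n t)‖
        = ‖inner ℂ (v - ρ (ρ y)) (W n s - W n t) + inner ℂ (ρ (ρ y)) (W n s - W n t)‖ := by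
          rw [inner_sub_left, sub_add_cancel]
      _ ≤ _ := norm_add_le _ _
      _ ≤ ε := by linarith
  refine ⟨w, ?_, fun t ht => ?_, fun y t ht => ?_⟩
  · refine ext_inner_left ℂ fun v => ?_
    refine tendsto_nhds_unique (hw 0 (by simp) v) ?_
    simp only [hW0]
    exact (tendsto_const_nhds.inner (hJJ w₀)).mono_left hU
  · exact defectForm_le_of_weak_limit hρ D.defectForm_nonneg (hw t ht) fun n => hWb n t ht
  · have hJy : Tendsto (fun n => ‖(ρ * N n) ((ρ * N n) y) - y‖) U (𝓝 0) := by
      simpa using (((hJJ y).sub_const y).norm).mono_left hU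
    have hcn : Tendsto (fun n => inner ℂ ((ρ * N n) ((ρ * N n) y)) (k t (W n t))) U
        (𝓝 (inner ℂ y (k t (w t)))) := by
      have h1 : Tendsto (fun n => inner ℂ ((ρ * N n) ((ρ * N n) y) - y) (k t (W n t))) U
          (𝓝 0) := by
        refine squeeze_zero_norm (fun n => ?_) (by simpa using hJy.mul_const (Λ * M))
        exact (norm_inner_le_norm _ _).trans
          (mul_le_mul_of_nonneg_left (hkW n t ht) (norm_nonneg _))
      have h2 := h1.add (hw t ht (k t y))
      rw [zero_add, (D.selfAdjoint t ht).inner_comm] at h2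
      refine h2.congr fun n => ?_
      rw [(D.selfAdjoint t ht).inner_comm, inner_sub_left, sub_add_cancel]
    rw [hasDerivWithinAt_iff_isLittleO, Asymptotics.isLittleO_iff]
    intro ε hε
    obtain ⟨δ₁, hδ₁, h1⟩ := hequi (k t y) (ε / 2) (by positivity)
    obtain ⟨δ₂, hδ₂, h2⟩ := Metric.continuous_iff.mp D.continuous t (ε / 2 / (‖y‖ * M + 1))
      (by positivity)
    have hball : Metric.ball t (min δ₁ δ₂) ∈ 𝓝[Ico 0 1] t :=
      nhdsWithin_le_nhds (Metric.ball_mem_nhds t (lt_min hδ₁ hδ₂))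
    filter_upwards [hball, self_mem_nhdsWithin] with s hs hsI
    -- The mean value inequality for `W n` minus its linearization at `t`. The neighbourhood of `t`
    -- does not depend on `n`, so the first-order estimate passes to the limit.
    have hn : ∀ n, ‖(inner ℂ (ρ (ρ y)) (W n s) - s • (-Complex.I *
          inner ℂ ((ρ * N n) ((ρ * N n) y)) (k t (W n t)))) -
        (inner ℂ (ρ (ρ y)) (W n t) - t • (-Complex.I *
          inner ℂ ((ρ * N n) ((ρ * N n) y)) (k t (W n t))))‖ ≤
        (‖(ρ * N n) ((ρ * N n) y) - y‖ * (2 * (Λ * M)) + ε) * ‖s - t‖ := by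
      intro n
      set c := -Complex.I * inner ℂ ((ρ * N n) ((ρ * N n) y)) (k t (W n t)) with hc
      refine ((convex_Ico (0 : ℝ) 1).inter (convex_ball t (min δ₁ δ₂)))
        |>.norm_image_sub_le_of_norm_hasDerivWithin_le
        (f := fun r => inner ℂ (ρ (ρ y)) (W n r) - r • c)
        (f' := fun r => -Complex.I * inner ℂ ((ρ * N n) ((ρ * N n) y)) (k r (W n r)) - c)
        (fun r hr => ?_) (fun r hr => ?_) ⟨ht, Metric.mem_ball_self (lt_min hδ₁ hδ₂)⟩ ⟨hsI, hs⟩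
      · have h3 := ((hasDerivAt_id r).smul_const c).hasDerivWithinAt
          (s := Ico (0 : ℝ) 1 ∩ Metric.ball t (min δ₁ δ₂))
        rw [one_smul] at h3
        exact ((hWd n y r (Ico_subset_Icc_self hr.1)).mono
          (inter_subset_left.trans Ico_subset_Icc_self)).sub h3
      · have hr2 := Metric.mem_ball.mp hr.2
        have h3 := h1 n r hr.1 t ht (hr2.trans_le (min_le_left _ _))
        have h4 := h2 r (hr2.trans_le (min_le_right _ _))
        rw [dist_eq_norm, lt_div_iff₀ (by positivity)] at h4
        have h5 : ‖inner ℂ y ((k r - k t) (W n r))‖ ≤ ε / 2 := by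
          calc ‖inner ℂ y ((k r - k t) (W n r))‖ ≤ ‖y‖ * ‖(k r - k t) (W n r)‖ :=
                norm_inner_le_norm _ _
            _ ≤ ‖y‖ * (‖k r - k t‖ * M) := by
              gcongr
              exact ((k r - k t).le_opNorm _).trans (by gcongr; exact hM n r hr.1)
            _ = ‖k r - k t‖ * (‖y‖ * M) := by ring
            _ ≤ ε / 2 := by nlinarith [norm_nonneg (k r - k t)]
        have h6 : ‖inner ℂ ((ρ * N n) ((ρ * N n) y) - y) (k r (W n r) - k t (W n t))‖ ≤
            ‖(ρ * N n) ((ρ * N n) y) - y‖ * (2 * (Λ * M)) := by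
          refine (norm_inner_le_norm _ _).trans ?_
          gcongr
          exact (norm_sub_le _ _).trans (by linarith [hkW n r hr.1, hkW n t ht])
        have h7 : -Complex.I * inner ℂ ((ρ * N n) ((ρ * N n) y)) (k r (W n r)) - c =
            -Complex.I * (inner ℂ ((ρ * N n) ((ρ * N n) y) - y) (k r (W n r) - k t (W n t)) +
              inner ℂ y ((k r - k t) (W n r)) + inner ℂ (k t y) (W n r - W n t)) := by
          rw [hc, (D.selfAdjoint t ht).inner_comm]
          simp only [sub_apply, inner_sub_left, inner_sub_right, map_sub]
          ring
        rw [h7, norm_mul, norm_neg, Complex.norm_I, one_mul]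
        refine (norm_add_le _ _).trans ?_
        have h8 := norm_add_le (inner ℂ ((ρ * N n) ((ρ * N n) y) - y) (k r (W n r) - k t (W n t)))
          (inner ℂ y ((k r - k t) (W n r)))
        linarith
    have hL : Tendsto (fun n => ‖(inner ℂ (ρ (ρ y)) (W n s) - s • (-Complex.I *
          inner ℂ ((ρ * N n) ((ρ * N n) y)) (k t (W n t)))) -
        (inner ℂ (ρ (ρ y)) (W n t) - t • (-Complex.I *
          inner ℂ ((ρ * N n) ((ρ * N n) y)) (k t (W n t))))‖) U
        (𝓝 ‖(inner ℂ (ρ (ρ y)) (w s) - s • (-Complex.I * inner ℂ y (k t (w t)))) -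
          (inner ℂ (ρ (ρ y)) (w t) - t • (-Complex.I * inner ℂ y (k t (w t))))‖) :=
      (((hw s hsI _).sub ((hcn.const_mul _).const_smul s)).sub
        ((hw t ht _).sub ((hcn.const_mul _).const_smul t))).norm
    have hR : Tendsto (fun n => (‖(ρ * N n) ((ρ * N n) y) - y‖ * (2 * (Λ * M)) + ε) * ‖s - t‖) U
        (𝓝 (ε * ‖s - t‖)) := by
      simpa using ((hJy.mul_const (2 * (Λ * M))).add_const ε).mul_const ‖s - t‖
    have hfin := le_of_tendsto_of_tendsto' hL hR hn
    refine le_trans (le_of_eq ?_) hfin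
    congr 1
    rw [sub_smul]
    ring

end IsEvolutionData

end Evolution

/-! ### From distributional to pointwise solutions -/

section Evolution

variable {E : Type*} [NormedAddCommGroup E] [InnerProductSpace ℂ E] [CompleteSpace E]

/-- Both sides equal `‖ρ u‖² - ‖R u‖²`. -/
theorem resolventForm_eq_defectForm {ρ R : E →L[ℂ] E} (hρ : IsSelfAdjoint ρ)
    (hρ2 : ∀ w, ρ (ρ w) = R w) (u : E) : resolventForm R u = defectForm ρ (ρ u) := by
  rw [resolventForm, defectForm, inner_sub_right, Complex.sub_re, re_inner_self_eq, ← hρ2,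
    hρ.inner_comm, re_inner_self_eq]

/-- A distributional solution, known only almost everywhere, has a representative which is a weak
solution in the pointwise sense. -/
theorem exists_isWeakEvolution_of_distributional {ρ : E →L[ℂ] E} {k : ℝ → E →L[ℂ] E}
    (hρ : IsSelfAdjoint ρ) (hinj : Function.Injective ρ) (hk : Continuous k)
    (hsa : ∀ t ∈ Ico (0 : ℝ) 1, IsSelfAdjoint (k t)) {x ζ : ℝ → E} {M : ℝ}
    (hx : ContinuousOn x (Ico 0 1))
    (hζ : ∀ᵐ t ∂(volume.restrict (Ioo (0 : ℝ) 1)), ρ (ζ t) = x t)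
    (hM : ∀ᵐ t ∂(volume.restrict (Ioo (0 : ℝ) 1)), ‖ζ t‖ ≤ M)
    (heq : ∀ (y : E) (φ : ℝ → ℝ), ContDiff ℝ ∞ φ → HasCompactSupport φ → tsupport φ ⊆ Ioo 0 1 →
      -∫ t in Ioo (0 : ℝ) 1, ((deriv φ t : ℝ) : ℂ) * (Complex.I * inner ℂ (ρ y) (ρ (ζ t))) =
        ∫ t in Ioo (0 : ℝ) 1, (φ t : ℂ) * inner ℂ y (k t (ζ t))) :
    ∃ w : ℝ → E, (∀ t ∈ Ico (0 : ℝ) 1, ρ (w t) = x t) ∧ IsWeakEvolution ρ k w := by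
  have hlim : ∀ t, ∃ w : E, t ∈ Ico (0 : ℝ) 1 → ρ w = x t ∧ ‖w‖ ≤ M := by
    intro t
    by_cases ht : t ∈ Ico (0 : ℝ) 1
    swap
    · exact ⟨0, fun h => absurd h ht⟩
    -- Times at which the representative is good form a dense set, so each `t`, including `0`, is a
    -- limit of such times. A weak limit of the bounded vectors `ζ s` along them is identified
    -- through the continuity of `x`, which gives a representative bounded at every time.
    have hd : Dense {s : ℝ | s ∈ Ioo (0 : ℝ) 1 → ρ (ζ s) = x s ∧ ‖ζ s‖ ≤ M} :=
      Measure.dense_of_ae ((ae_restrict_iff' measurableSet_Ioo).mp (hζ.and hM))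
    have hcl : t ∈ closure (Ioo (0 : ℝ) 1 ∩
        {s : ℝ | s ∈ Ioo (0 : ℝ) 1 → ρ (ζ s) = x s ∧ ‖ζ s‖ ≤ M}) := by
      have h1 := closure_minimal (hd.open_subset_closure_inter
        (isOpen_Ioo (a := (0 : ℝ)) (b := 1))) isClosed_closure
      rw [closure_Ioo zero_ne_one] at h1
      exact h1 (Ico_subset_Icc_self ht)
    set G := Ioo (0 : ℝ) 1 ∩ {s : ℝ | s ∈ Ioo (0 : ℝ) 1 → ρ (ζ s) = x s ∧ ‖ζ s‖ ≤ M} with hG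
    have : (𝓝[G] t).NeBot := mem_closure_iff_nhdsWithin_neBot.mp hcl
    let U : Ultrafilter ℝ := Ultrafilter.of (𝓝[G] t)
    have hU : (U : Filter ℝ) ≤ 𝓝[G] t := Ultrafilter.of_le _
    have hGU : ∀ᶠ s in (U : Filter ℝ), s ∈ G := hU self_mem_nhdsWithin
    obtain ⟨w, hw, hwlim⟩ := exists_weak_limit U (hGU.mono fun s hs => (hs.2 hs.1).2)
    refine ⟨w, fun _ => ⟨?_, hw⟩⟩
    refine ext_inner_left ℂ fun y => ?_
    rw [← hρ.inner_comm]
    refine tendsto_nhds_unique (hwlim (ρ y)) ?_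
    have hxt : Tendsto x U (𝓝 (x t)) :=
      (hx t ht).mono_left (hU.trans (nhdsWithin_mono t fun s hs => Ioo_subset_Ico_self hs.1))
    refine (tendsto_const_nhds.inner hxt).congr' ?_
    filter_upwards [hGU] with s hs
    rw [hρ.inner_comm, (hs.2 hs.1).1]
  choose w hw using hlim
  have hwM : ∀ t ∈ Ico (0 : ℝ) 1, ‖w t‖ ≤ M := fun t ht => (hw t ht).2
  have hwx : ∀ t ∈ Ico (0 : ℝ) 1, ρ (w t) = x t := fun t ht => (hw t ht).1
  have hρw : ContinuousOn (fun t => ρ (w t)) (Ico 0 1) := hx.congr hwx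
  have hweak : ∀ v, ContinuousOn (fun t => inner ℂ v (w t)) (Ico 0 1) :=
    continuousOn_inner_of_dense (hρ.denseRange_of_injective hinj) hwM fun y => by
      simp only [hρ.inner_comm]
      exact continuousOn_const.inner hρw
  have hkw := continuousOn_inner_apply hwM hweak hk hsa
  have hae : ∀ᵐ t ∂(volume.restrict (Ioo (0 : ℝ) 1)), ζ t = w t := by
    filter_upwards [hζ, ae_restrict_mem measurableSet_Ioo] with t ht htI
    exact hinj (ht.trans (hwx t (Ioo_subset_Ico_self htI)).symm)
  refine ⟨w, hwx, hρw, fun y t ht => ?_⟩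
  refine hasDerivAt_of_integral_deriv_smul_eq_neg
    (g' := fun t => -Complex.I * inner ℂ y (k t (w t)))
    ((hweak _).mono Ioo_subset_Ico_self)
    (continuousOn_const.mul ((hkw y).mono Ioo_subset_Ico_self)) (fun φ hφ hφc hφs => ?_) ht
  have h1 := heq y φ hφ hφc hφs
  have h2 : ∫ t in Ioo (0 : ℝ) 1, ((deriv φ t : ℝ) : ℂ) *
      (Complex.I * inner ℂ (ρ y) (ρ (ζ t))) =
      Complex.I * ∫ t in Ioo (0 : ℝ) 1, deriv φ t • inner ℂ (ρ (ρ y)) (w t) := by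
    rw [← integral_const_mul]
    refine integral_congr_ae ?_
    filter_upwards [hae] with t ht
    rw [ht, Complex.real_smul, hρ.inner_comm (ρ y)]
    ring
  have h3 : ∫ t in Ioo (0 : ℝ) 1, (φ t : ℂ) * inner ℂ y (k t (ζ t)) =
      Complex.I * ∫ t in Ioo (0 : ℝ) 1, φ t • (-Complex.I * inner ℂ y (k t (w t))) := by
    rw [← integral_const_mul]
    refine integral_congr_ae ?_
    filter_upwards [hae] with t ht
    rw [ht, Complex.real_smul]
    linear_combination (φ t : ℂ) * inner ℂ y (k t (w t)) * Complex.I_sq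
  rw [h2, h3, ← mul_neg] at h1
  have h4 := mul_left_cancel₀ Complex.I_ne_zero h1
  rw [← h4, neg_neg]

end Evolution

/-! ### The form domain as the range of the square root of the resolvent -/

namespace PosSelfAdjoint

variable {E : Type*} [NormedAddCommGroup E] [InnerProductSpace ℂ E] [CompleteSpace E]
  {T : PosSelfAdjoint E} {R : E →L[ℂ] E}

theorem inner_op_comm (T : PosSelfAdjoint E) (x y : T.op.domain) :
    inner ℂ (T.op x) (y : E) = inner ℂ (x : E) (T.op y) := by
  have h := LinearPMap.adjoint_isFormalAdjoint (T := T.op) T.isSelfAdjoint.dense_domain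
  rw [LinearPMap.isSelfAdjoint_def.mp T.isSelfAdjoint] at h
  exact h x y

namespace IsResolvent

theorem mem_domain (hR : T.IsResolvent R) (u : E) : R u ∈ T.op.domain := (hR.1 u).1

theorem op_apply (hR : T.IsResolvent R) (u : E) : T.op ⟨R u, hR.mem_domain u⟩ = u - R u :=
  eq_sub_of_add_eq (hR.1 u).2

theorem selfAdjoint (hR : T.IsResolvent R) : IsSelfAdjoint R := by
  rw [ContinuousLinearMap.isSelfAdjoint_iff_isSymmetric]
  intro x y
  have h := T.inner_op_comm ⟨R x, hR.mem_domain x⟩ ⟨R y, hR.mem_domain y⟩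
  rw [hR.op_apply, hR.op_apply, inner_sub_left, inner_sub_right] at h
  simpa using h.symm

theorem injective (hR : T.IsResolvent R) : Function.Injective R := by
  rw [injective_iff_map_eq_zero]
  intro x hx
  have h := hR.op_apply x
  have h0 : (⟨R x, hR.mem_domain x⟩ : T.op.domain) = 0 := Subtype.ext hx
  rw [h0, LinearPMap.map_zero, hx, sub_zero] at h
  exact h.symm

theorem energy_eq (hR : T.IsResolvent R) (u : E) :
    T.energy ⟨R u, hR.mem_domain u⟩ = resolventForm R u := by
  rw [energy, hR.op_apply, resolventForm]

theorem resolventForm_nonneg (hR : T.IsResolvent R) (u : E) : 0 ≤ resolventForm R u := by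
  rw [← hR.energy_eq]
  exact T.nonneg _

theorem re_inner_nonneg (hR : T.IsResolvent R) (u : E) : 0 ≤ (inner ℂ u (R u)).re := by
  have h := hR.resolventForm_nonneg u
  rw [resolventForm, inner_sub_right, Complex.sub_re, re_inner_self_eq,
    hR.selfAdjoint.inner_comm] at h
  linarith [sq_nonneg ‖R u‖]

end IsResolvent

section Sqrt

variable {ρ : E →L[ℂ] E}

theorem apply_sqrt_op_add (hR : T.IsResolvent R) (hρ2 : ∀ w, ρ (ρ w) = R w) (x : T.op.domain) :
    ρ (ρ (T.op x + x)) = x := by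
  rw [hρ2, hR.2]

/-- Since `x = R (T x + x)`, the vector `ρ (T x + x)` is the preimage of `x` under `ρ`. -/
theorem energy_eq_defectForm (hR : T.IsResolvent R) (hρ : IsSelfAdjoint ρ)
    (hρ2 : ∀ w, ρ (ρ w) = R w) (x : T.op.domain) :
    T.energy x = defectForm ρ (ρ (T.op x + x)) := by
  have h1 := hR.energy_eq (T.op x + x)
  have h2 : (⟨R (T.op x + x), hR.mem_domain _⟩ : T.op.domain) = x := Subtype.ext (hR.2 x)
  rw [h2, resolventForm_eq_defectForm hρ hρ2] at h1
  exact h1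

theorem isFormApprox_of_tendsto (hR : T.IsResolvent R) (hρ : IsSelfAdjoint ρ)
    (hρ2 : ∀ w, ρ (ρ w) = R w) {w : E} {u : ℕ → T.op.domain}
    (hu : Tendsto (fun n => ρ (T.op (u n) + u n)) atTop (𝓝 w)) : T.IsFormApprox (ρ w) u := by
  constructor
  · refine ((ρ.continuous.tendsto w).comp hu).congr fun n => ?_
    exact apply_sqrt_op_add hR hρ2 (u n)
  · have h1 : Tendsto (fun p : ℕ × ℕ => ρ (T.op (u p.1) + u p.1) - ρ (T.op (u p.2) + u p.2)) atTop
        (𝓝 0) := by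
      rw [← sub_self w, ← prod_atTop_atTop_eq]
      exact (hu.comp tendsto_fst).sub (hu.comp tendsto_snd)
    have h2 := ((continuous_defectForm ρ).tendsto 0).comp h1
    have h3 : defectForm ρ 0 = 0 := by simp [defectForm]
    rw [h3] at h2
    refine h2.congr fun p => ?_
    rw [energy_eq_defectForm hR hρ hρ2, Function.comp_apply, LinearPMap.map_sub, ← map_sub]
    congr 2
    rw [Submodule.coe_sub]
    abel

theorem exists_tendsto_sqrt (hR : T.IsResolvent R) (hρ : IsSelfAdjoint ρ)
    (hinj : Function.Injective ρ) (w : E) :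
    ∃ u : ℕ → T.op.domain, Tendsto (fun n => ρ (T.op (u n) + u n)) atTop (𝓝 w) := by
  obtain ⟨v, hv, hlim⟩ := mem_closure_iff_seq_limit.mp (hρ.denseRange_of_injective hinj w)
  choose v' hv' using hv
  refine ⟨fun n => ⟨R (v' n), hR.mem_domain _⟩, hlim.congr fun n => ?_⟩
  rw [hR.op_apply, sub_add_cancel, hv']

theorem apply_sqrt_mem_formDomain (hR : T.IsResolvent R) (hρ : IsSelfAdjoint ρ)
    (hinj : Function.Injective ρ) (hρ2 : ∀ w, ρ (ρ w) = R w) (w : E) : ρ w ∈ T.formDomain := by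
  obtain ⟨u, hu⟩ := exists_tendsto_sqrt hR hρ hinj w
  exact ⟨u, isFormApprox_of_tendsto hR hρ hρ2 hu⟩

theorem form_apply_sqrt (hR : T.IsResolvent R) (hρ : IsSelfAdjoint ρ)
    (hinj : Function.Injective ρ) (hρ2 : ∀ w, ρ (ρ w) = R w) (w : E) (h : ρ w ∈ T.formDomain) :
    T.form ⟨ρ w, h⟩ = defectForm ρ w := by
  obtain ⟨u, hu⟩ := exists_tendsto_sqrt hR hρ hinj w
  have h1 := T.tendsto_form ⟨ρ w, h⟩ (isFormApprox_of_tendsto hR hρ hρ2 hu)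
  refine tendsto_nhds_unique h1 ?_
  simp only [energy_eq_defectForm hR hρ hρ2]
  exact ((continuous_defectForm ρ).tendsto w).comp hu

/-- The energy of `ρ w` plus `‖ρ w‖²` equals `‖w‖²`, so a sequence that is Cauchy in the form norm
lifts to a Cauchy sequence of preimages, which converges. -/
theorem exists_apply_sqrt_eq (hR : T.IsResolvent R) (hρ : IsSelfAdjoint ρ)
    (hρ2 : ∀ w, ρ (ρ w) = R w) {x : E} (hx : x ∈ T.formDomain) : ∃ w, ρ w = x := by
  obtain ⟨u, hu, hu'⟩ := hx
  have hcauchy : CauchySeq fun n => ρ (T.op (u n) + u n) := by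
    rw [cauchySeq_iff_tendsto_dist_atTop_0]
    have h1 : Tendsto (fun p : ℕ × ℕ => (u p.1 : E) - u p.2) atTop (𝓝 0) := by
      rw [← sub_self x, ← prod_atTop_atTop_eq]
      exact (hu.comp tendsto_fst).sub (hu.comp tendsto_snd)
    have h2 := (hu'.add (h1.norm.pow 2)).sqrt
    simp only [norm_zero, ne_eq, OfNat.ofNat_ne_zero, not_false_eq_true, zero_pow, add_zero,
      Real.sqrt_zero] at h2
    refine h2.congr fun p => ?_
    have h3 := energy_eq_defectForm hR hρ hρ2 (u p.1 - u p.2)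
    rw [defectForm, apply_sqrt_op_add hR hρ2, Submodule.coe_sub] at h3
    rw [h3, sub_add_cancel, Real.sqrt_sq (norm_nonneg _), dist_eq_norm, ← map_sub,
      LinearPMap.map_sub]
    congr 2
    abel
  obtain ⟨w, hw⟩ := cauchySeq_tendsto_of_complete hcauchy
  refine ⟨w, tendsto_nhds_unique ((ρ.continuous.tendsto w).comp hw) ?_⟩
  refine hu.congr fun n => ?_
  exact (apply_sqrt_op_add hR hρ2 (u n)).symm

/-- It suffices to check `w = ρ v`, where `ρ w = R v` lies in the operator domain; such `w` are
dense and both sides are continuous. -/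
theorem norm_sq_le_defectForm (hR : T.IsResolvent R) (hρ : IsSelfAdjoint ρ)
    (hinj : Function.Injective ρ) (hρ2 : ∀ w, ρ (ρ w) = R w)
    (h1 : ∀ x : T.op.domain, ‖(x : E)‖ ^ 2 ≤ (inner ℂ (x : E) (T.op x)).re) (w : E) :
    ‖ρ w‖ ^ 2 ≤ defectForm ρ w := by
  refine (hρ.denseRange_of_injective hinj).induction_on
    (p := fun w => ‖ρ w‖ ^ 2 ≤ defectForm ρ w) w
    (isClosed_le (by fun_prop) (continuous_defectForm ρ)) fun v => ?_
  rw [hρ2, ← resolventForm_eq_defectForm hρ hρ2, ← hR.energy_eq]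
  exact h1 ⟨R v, hR.mem_domain v⟩

theorem exists_sqrt_resolvent (hR : T.IsResolvent R) :
    ∃ ρ : E →L[ℂ] E, IsSelfAdjoint ρ ∧ Function.Injective ρ ∧ (∀ w, ρ (ρ w) = R w) ∧
      ∀ X : E →L[ℂ] E, Commute R X → Commute ρ X := by
  obtain ⟨ρ, hρ, hρ2, hc⟩ := exists_selfAdjoint_sqrt hR.selfAdjoint hR.re_inner_nonneg
  refine ⟨ρ, hρ, fun x y hxy => hR.injective ?_, hρ2, hc⟩
  rw [← hρ2, ← hρ2, hxy]

end Sqrt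

end PosSelfAdjoint

/-! ### Relative form bound and passage to bounded operators -/

namespace PosSelfAdjoint

variable {E : Type*} [NormedAddCommGroup E] [InnerProductSpace ℂ E] [CompleteSpace E]
  {A B : PosSelfAdjoint E} {R S ρ σ : E →L[ℂ] E}

/-- By the closed graph theorem, `B` is form bounded relative to `A` if `Q(A) ⊆ Q(B)`. -/
theorem exists_norm_le_of_formDomain_le (hR : A.IsResolvent R) (hρ : IsSelfAdjoint ρ)
    (hρinj : Function.Injective ρ) (hρ2 : ∀ w, ρ (ρ w) = R w) (hS : B.IsResolvent S)
    (hσ : IsSelfAdjoint σ) (hσinj : Function.Injective σ) (hσ2 : ∀ w, σ (σ w) = S w)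
    (hQ : A.formDomain ≤ B.formDomain) :
    ∃ c : ℝ, ∀ w, ∃ v, σ v = ρ w ∧ ‖v‖ ≤ c * ‖w‖ := by
  choose g hg using fun w =>
    exists_apply_sqrt_eq hS hσ hσ2 (hQ (apply_sqrt_mem_formDomain hR hρ hρinj hρ2 w))
  let G : E →ₗ[ℂ] E :=
    { toFun := g
      map_add' := fun x y => hσinj (by rw [map_add, hg, hg, hg, map_add])
      map_smul' := fun c x => hσinj (by rw [map_smul, hg, hg, map_smul, RingHom.id_apply]) }
  have hG : Continuous G := by
    refine G.continuous_of_seq_closed_graph fun u x y hu hGu => hσinj ?_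
    change σ y = σ (g x)
    rw [hg]
    refine tendsto_nhds_unique ((σ.continuous.tendsto y).comp hGu) ?_
    refine ((ρ.continuous.tendsto x).comp hu).congr fun n => ?_
    exact (hg (u n)).symm
  exact ⟨‖(⟨G, hG⟩ : E →L[ℂ] E)‖, fun w => ⟨g w, hg w, (⟨G, hG⟩ : E →L[ℂ] E).le_opNorm w⟩⟩

theorem form_nonneg (A : PosSelfAdjoint E) (x : A.formDomain) : 0 ≤ A.form x := by
  obtain ⟨u, hu⟩ := x.2
  exact ge_of_tendsto' (A.tendsto_form x hu) fun n => A.nonneg _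

theorem form_smul_apply (hR : A.IsResolvent R) (hρ : IsSelfAdjoint ρ)
    (hρinj : Function.Injective ρ) (hρ2 : ∀ w, ρ (ρ w) = R w) (c : ℂ) (x : A.formDomain) :
    A.form (c • x) = ‖c‖ ^ 2 * A.form x := by
  obtain ⟨x, hx⟩ := x
  obtain ⟨w, rfl⟩ := exists_apply_sqrt_eq hR hρ hρ2 hx
  have h : c • (⟨ρ w, hx⟩ : A.formDomain) =
      ⟨ρ (c • w), apply_sqrt_mem_formDomain hR hρ hρinj hρ2 _⟩ :=
    Subtype.ext (by simp)
  rw [h, form_apply_sqrt hR hρ hρinj hρ2, form_apply_sqrt hR hρ hρinj hρ2, defectForm_smul]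

theorem relFormBound_nonneg (hQ : A.formDomain ≤ B.formDomain) :
    0 ≤ A.relFormBound B hQ := by
  refine Real.sSup_nonneg ?_
  rintro _ ⟨x, _, rfl⟩
  exact B.form_nonneg _

/-- The closed graph theorem gives some finite constant; this bounds the set in the supremum, whose
real value would otherwise be meaningless. Scaling to unit `A`-energy then gives the sharp constant,
while vectors of zero `A`-energy are covered by the crude one. -/
theorem form_le_relFormBound_mul (hR : A.IsResolvent R) (hρ : IsSelfAdjoint ρ)
    (hρinj : Function.Injective ρ) (hρ2 : ∀ w, ρ (ρ w) = R w) (hS : B.IsResolvent S)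
    (h1 : ∀ w, ‖ρ w‖ ^ 2 ≤ defectForm ρ w)
    (hQ : A.formDomain ≤ B.formDomain) (x : A.formDomain) :
    B.form (Submodule.inclusion hQ x) ≤ A.relFormBound B hQ * A.form x := by
  obtain ⟨σ, hσ, hσinj, hσ2, -⟩ := exists_sqrt_resolvent hS
  obtain ⟨c, hc⟩ := exists_norm_le_of_formDomain_le hR hρ hρinj hρ2 hS hσ hσinj hσ2 hQ
  have hle : ∀ x : A.formDomain, B.form (Submodule.inclusion hQ x) ≤ 2 * c ^ 2 * A.form x := by
    rintro ⟨x, hx⟩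
    obtain ⟨w, rfl⟩ := exists_apply_sqrt_eq hR hρ hρ2 hx
    obtain ⟨v, hv, hvle⟩ := hc w
    have h2 : Submodule.inclusion hQ ⟨ρ w, hx⟩ =
        ⟨σ v, apply_sqrt_mem_formDomain hS hσ hσinj hσ2 v⟩ := Subtype.ext hv.symm
    rw [h2, form_apply_sqrt hS hσ hσinj hσ2, form_apply_sqrt hR hρ hρinj hρ2]
    have h3 := h1 w
    have h4 : ‖v‖ ^ 2 ≤ (c * ‖w‖) ^ 2 := by gcongr
    unfold defectForm at h3 ⊢
    nlinarith [sq_nonneg ‖σ v‖, sq_nonneg c]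
  have hbdd : BddAbove {r | ∃ x : A.formDomain, A.form x ≤ 1 ∧
      r = B.form (Submodule.inclusion hQ x)} := by
    refine ⟨2 * c ^ 2, ?_⟩
    rintro _ ⟨x, hx, rfl⟩
    exact (hle x).trans (mul_le_of_le_one_right (by positivity) hx)
  rcases (A.form_nonneg x).eq_or_lt with h0 | h0
  · rw [← h0, mul_zero]
    simpa [← h0] using hle x
  · obtain ⟨a, ha, ha2⟩ : ∃ a : ℝ, 0 < a ∧ a ^ 2 * A.form x = 1 :=
      ⟨(√(A.form x))⁻¹, by positivity, by
        rw [inv_pow, Real.sq_sqrt h0.le, inv_mul_cancel₀ h0.ne']⟩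
    have h2 : A.form ((a : ℂ) • x) = 1 := by
      rw [form_smul_apply hR hρ hρinj hρ2, Complex.norm_real, Real.norm_of_nonneg ha.le, ha2]
    have h3 : B.form (Submodule.inclusion hQ ((a : ℂ) • x)) =
        a ^ 2 * B.form (Submodule.inclusion hQ x) := by
      rw [map_smul, form_smul_apply hS hσ hσinj hσ2, Complex.norm_real,
        Real.norm_of_nonneg ha.le]
    have h4 : B.form (Submodule.inclusion hQ ((a : ℂ) • x)) ≤ A.relFormBound B hQ :=
      le_csSup hbdd ⟨_, h2.le, rfl⟩
    rw [h3] at h4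
    calc B.form (Submodule.inclusion hQ x)
        = (a ^ 2 * A.form x) * B.form (Submodule.inclusion hQ x) := by rw [ha2, one_mul]
      _ = (a ^ 2 * B.form (Submodule.inclusion hQ x)) * A.form x := by ring
      _ ≤ _ := by gcongr

/-- The form of `B` on the range of its resolvent. -/
theorem form_apply_resolvent (hS : B.IsResolvent S) (u : E) (h : S u ∈ B.formDomain) :
    B.form ⟨S u, h⟩ = resolventForm S u := by
  obtain ⟨σ, hσ, hσinj, hσ2, -⟩ := exists_sqrt_resolvent hS
  rw [resolventForm_eq_defectForm hσ hσ2,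
    ← form_apply_sqrt hS hσ hσinj hσ2 (σ u) (by rw [hσ2]; exact h)]
  congr 2
  exact (hσ2 u).symm

/-- The bounded reformulation of the family of forms `H(t)`. -/
theorem exists_isEvolutionData {C : ℝ} (hC : 0 < C)
    {H : ℝ → A.formDomain →ₗ⋆[ℂ] A.formDomain →ₗ[ℂ] ℂ}
    (hA : ∀ x : A.op.domain, ‖(x : E)‖ ^ 2 ≤ (inner ℂ (x : E) (A.op x)).re)
    (hsymm : ∀ t ∈ Ico (0 : ℝ) 1, ∀ x y : A.formDomain, H t x y = conj (H t y x))
    (hcomm : A.StronglyCommute B) (hQ : A.formDomain ≤ B.formDomain)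
    (hup : ∀ t ∈ Ico (0 : ℝ) 1, ∀ x : A.formDomain, (H t x x).re ≤ C * A.form x)
    (hlow : ∀ t ∈ Ico (0 : ℝ) 1, ∀ x : A.formDomain,
      C⁻¹ * A.form x - C * B.form (Submodule.inclusion hQ x) ≤ (H t x x).re)
    (hbr : ∀ t ∈ Ico (0 : ℝ) 1, ∀ (x : A.formDomain) (hx : (x : E) ∈ B.op.domain)
      (hBx : B.op ⟨x, hx⟩ ∈ A.formDomain),
      (Complex.I * (H t x ⟨B.op ⟨x, hx⟩, hBx⟩ - H t ⟨B.op ⟨x, hx⟩, hBx⟩ x)).re ≤ C * A.form x)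
    (hder : ∀ t ∈ Ico (0 : ℝ) 1, ∀ x : A.formDomain, ∃ d : ℝ,
      HasDerivWithinAt (fun s => (H s x x).re) d (Ico 0 1) t ∧
        -(C * A.form x) ≤ d ∧ d ≤ C * A.form x) :
    ∃ (Φ : E →ₗ[ℂ] A.formDomain) (ρ S : E →L[ℂ] E) (k : ℝ → E →L[ℂ] E),
      IsEvolutionData ρ S k C (A.relFormBound B hQ) ∧ (∀ w, (Φ w : E) = ρ w) ∧
      Function.Surjective Φ ∧ (∀ w, A.form (Φ w) = defectForm ρ w) ∧
      ∀ t ∈ Ico (0 : ℝ) 1, ∀ w v, inner ℂ w (k t v) = H t (Φ w) (Φ v) := by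
  obtain ⟨R, S, hR, hS, hRS⟩ := hcomm
  obtain ⟨ρ, hρ, hρinj, hρ2, hρc⟩ := exists_sqrt_resolvent hR
  have hmem : ∀ w, ρ w ∈ A.formDomain := apply_sqrt_mem_formDomain hR hρ hρinj hρ2
  let Φ : E →ₗ[ℂ] A.formDomain := (ρ : E →ₗ[ℂ] E).codRestrict A.formDomain hmem
  have hΦ : ∀ w, (Φ w : E) = ρ w := fun w => rfl
  have hΦform : ∀ w, A.form (Φ w) = defectForm ρ w := fun w =>
    form_apply_sqrt hR hρ hρinj hρ2 w (hmem w)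
  have hΦsurj : Function.Surjective Φ := fun ⟨x, hx⟩ => by
    obtain ⟨w, rfl⟩ := exists_apply_sqrt_eq hR hρ hρ2 hx
    exact ⟨w, rfl⟩
  have h1 : ∀ w, ‖ρ w‖ ^ 2 ≤ defectForm ρ w := norm_sq_le_defectForm hR hρ hρinj hρ2 hA
  have hnn : ∀ w, 0 ≤ defectForm ρ w := fun w => (sq_nonneg _).trans (h1 w)
  have hdle : ∀ w, defectForm ρ w ≤ ‖w‖ ^ 2 := fun w => by
    unfold defectForm
    linarith [sq_nonneg ‖ρ w‖]
  set β := A.relFormBound B hQ with hβdef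
  have hβ : 0 ≤ β := relFormBound_nonneg hQ
  have hrel : ∀ x, B.form (Submodule.inclusion hQ x) ≤ β * A.form x :=
    form_le_relFormBound_mul hR hρ hρinj hρ2 hS h1 hQ
  have hop : ∀ t, ∃ h : E →L[ℂ] E, t ∈ Ico (0 : ℝ) 1 →
      IsSelfAdjoint h ∧ ∀ w v, inner ℂ w (h v) = H t (Φ w) (Φ v) := by
    intro t
    by_cases ht : t ∈ Ico (0 : ℝ) 1
    swap
    · exact ⟨0, fun h => absurd h ht⟩
    -- The constant `C + C * β` covers `H ≤ C A` from above and `H ≥ -C B ≥ -C β A` from below, with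
    -- the form of `A` at `Φ w` at most `‖w‖²`.
    obtain ⟨h, hh, hh'⟩ := exists_operator_of_sesq (q := ((H t).comp Φ).compl₂ Φ)
      (fun w v => hsymm t ht (Φ w) (Φ v)) (c := C + C * β) (fun w => by
        have h2 := hup t ht (Φ w)
        have h3 := hlow t ht (Φ w)
        have h4 := mul_le_mul_of_nonneg_left (hrel (Φ w)) hC.le
        rw [hΦform] at h2 h3 h4
        have h5 : 0 ≤ C⁻¹ * defectForm ρ w := mul_nonneg (inv_nonneg.mpr hC.le) (hnn w)
        have h6 : C * defectForm ρ w ≤ C * ‖w‖ ^ 2 := mul_le_mul_of_nonneg_left (hdle w) hC.le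
        have h7 : C * (β * defectForm ρ w) ≤ C * (β * ‖w‖ ^ 2) := by
          gcongr
          exact hdle w
        have h8 : 0 ≤ C * (β * ‖w‖ ^ 2) := by positivity
        have h9 : 0 ≤ C * ‖w‖ ^ 2 := by positivity
        rw [abs_le]
        change -((C + C * β) * ‖w‖ ^ 2) ≤ (H t (Φ w) (Φ w)).re ∧
          (H t (Φ w) (Φ w)).re ≤ (C + C * β) * ‖w‖ ^ 2
        constructor <;> linarith)
    exact ⟨h, fun _ => ⟨hh, hh'⟩⟩
  choose h hh using hop
  have hlip : ∀ s ∈ Ico (0 : ℝ) 1, ∀ t ∈ Ico (0 : ℝ) 1, ‖h s - h t‖ ≤ C * |s - t| := by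
    intro s hs t ht
    refine ((hh s hs).1.sub (hh t ht).1).norm_le_of_abs_re_inner_le (by positivity) fun w => ?_
    choose! d hd hd1 hd2 using fun r hr => hder r hr (Φ w)
    have h2 := (convex_Ico (0 : ℝ) 1).norm_image_sub_le_of_norm_hasDerivWithin_le
      (C := C * ‖w‖ ^ 2) hd (fun r hr => by
        have h3 := hd1 r hr
        have h4 := hd2 r hr
        rw [hΦform] at h3 h4
        have h5 := mul_le_mul_of_nonneg_left (hdle w) hC.le
        rw [Real.norm_eq_abs, abs_le]
        constructor <;> linarith) ht hs
    rw [sub_apply, inner_sub_right, (hh s hs).2, (hh t ht).2, Complex.sub_re]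
    rw [Real.norm_eq_abs, Real.norm_eq_abs] at h2
    linarith
  -- Nothing is assumed about `H` at `t = 1` or beyond; the extension supplies the continuous
  -- coefficients needed to solve the regularized equation on `[0, 1]`.
  obtain ⟨k, hk, hkh⟩ := exists_continuous_extension_of_lipschitz (h := h)
    (K := C.toNNReal) (LipschitzOnWith.of_dist_le_mul fun s hs t ht => by
      rw [dist_eq_norm, Real.dist_eq, Real.coe_toNNReal _ hC.le]
      exact hlip s hs t ht)
  have hkH : ∀ t ∈ Ico (0 : ℝ) 1, ∀ w v, inner ℂ w (k t v) = H t (Φ w) (Φ v) :=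
    fun t ht w v => by rw [hkh ht, (hh t ht).2]
  have hBS : ∀ w u, ρ w = S u → B.form (Submodule.inclusion hQ (Φ w)) = resolventForm S u := by
    intro w u hwu
    have hmemS : S u ∈ B.formDomain := hwu ▸ hQ (hmem w)
    rw [← form_apply_resolvent hS u hmemS]
    congr 1
    exact Subtype.ext hwu
  refine ⟨Φ, ρ, S, k, ?_, hΦ, hΦsurj, hΦform, hkH⟩
  refine
    { selfAdjoint_left := hρ
      injective_left := hρinj
      selfAdjoint_right := hS.selfAdjoint
      injective_right := hS.injective
      commute := hρc S hRS
      norm_sq_le := h1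
      resolventForm_nonneg := hS.resolventForm_nonneg
      pos := hC
      bound_nonneg := hβ
      continuous := hk
      lipschitz := ⟨C, fun s hs t ht => by rw [hkh hs, hkh ht]; exact hlip s hs t ht⟩
      selfAdjoint := fun t ht => by rw [hkh ht]; exact (hh t ht).1
      upper := fun t ht w => by
        rw [hkH t ht, ← hΦform]
        exact hup t ht (Φ w)
      lower := fun t ht w u hwu => by
        rw [hkH t ht, ← hΦform, ← hBS w u hwu]
        exact hlow t ht (Φ w)
      relative := fun w u hwu => by
        rw [← hΦform, ← hBS w u hwu]
        exact hrel (Φ w)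
      commutator := fun t ht w u w' hwu hw' => ?_
      deriv_le := fun t ht w => ?_ }
  · have hx : ((Φ w : A.formDomain) : E) ∈ B.op.domain := by
      rw [hΦ, hwu]
      exact hS.mem_domain u
    have hBw : B.op ⟨Φ w, hx⟩ = ρ w' := by
      have h2 : (⟨Φ w, hx⟩ : B.op.domain) = ⟨S u, hS.mem_domain u⟩ := Subtype.ext hwu
      rw [h2, hS.op_apply, hw']
    have hBx : B.op ⟨Φ w, hx⟩ ∈ A.formDomain := hBw ▸ hmem w'
    have h2 := hbr t ht (Φ w) hx hBx
    have h3 : (⟨B.op ⟨Φ w, hx⟩, hBx⟩ : A.formDomain) = Φ w' := Subtype.ext hBw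
    rw [h3, hΦform] at h2
    rwa [hkH t ht, hkH t ht]
  · obtain ⟨d, hd, -, hd2⟩ := hder t ht (Φ w)
    refine ⟨d, hd.congr (fun s hs => ?_) ?_, hΦform w ▸ hd2⟩
    · rw [hkH s hs]
    · rw [hkH t ht]

end PosSelfAdjoint

/-! ### Equivalence of the original and the bounded evolution problem -/

namespace PosSelfAdjoint

variable {E : Type*} [NormedAddCommGroup E] [InnerProductSpace ℂ E] [CompleteSpace E]
  {A : PosSelfAdjoint E} {H : ℝ → A.formDomain →ₗ⋆[ℂ] A.formDomain →ₗ[ℂ] ℂ}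
  {Φ : E →ₗ[ℂ] A.formDomain} {ρ S : E →L[ℂ] E} {k : ℝ → E →L[ℂ] E} {C β : ℝ}

/-- A weak solution of the bounded problem gives a solution of the original one. -/
theorem isSolution_of_weak (D : IsEvolutionData ρ S k C β) (hΦ : ∀ w, (Φ w : E) = ρ w)
    (hΦs : Function.Surjective Φ) (hΦf : ∀ w, A.form (Φ w) = defectForm ρ w)
    (hkH : ∀ t ∈ Ico (0 : ℝ) 1, ∀ w v, inner ℂ w (k t v) = H t (Φ w) (Φ v))
    {w : ℝ → E} {b : ℝ} (hb : ∀ t ∈ Ico (0 : ℝ) 1, defectForm ρ (w t) ≤ b)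
    (hw : ∀ y, ∀ t ∈ Ico (0 : ℝ) 1, HasDerivWithinAt (fun s => inner ℂ (ρ (ρ y)) (w s))
      (-Complex.I * inner ℂ y (k t (w t))) (Ico 0 1) t) :
    A.IsSolution H (Φ (w 0)) (fun t => ρ (w t)) ∧ IsWeakEvolution ρ k w := by
  have hρ := D.selfAdjoint_left
  have hM : ∀ t ∈ Ico (0 : ℝ) 1, ‖w t‖ ≤ √(2 * b) := fun t ht =>
    Real.le_sqrt_of_sq_le ((D.norm_sq_le_two_mul _).trans
      (mul_le_mul_of_nonneg_left (hb t ht) zero_le_two))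
  obtain ⟨Λ, hΛ⟩ := (isCompact_Icc (a := (0 : ℝ)) (b := 1)).exists_bound_of_continuousOn
    D.continuous.continuousOn
  have hcont := continuousOn_of_weak_hasDerivWithinAt hρ hM
    (fun t ht => hΛ t (Ico_subset_Icc_self ht)) hw
  have hweak : ∀ v, ContinuousOn (fun t => inner ℂ v (w t)) (Ico 0 1) :=
    continuousOn_inner_of_dense (hρ.denseRange_of_injective D.injective_left) hM fun y => by
      simp only [hρ.inner_comm]
      exact continuousOn_const.inner hcont
  have hkw := continuousOn_inner_apply hM hweak D.continuous D.selfAdjoint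
  have hwd : ∀ y, ∀ t ∈ Ioo (0 : ℝ) 1, HasDerivAt (fun s => inner ℂ (ρ (ρ y)) (w s))
      (-Complex.I * inner ℂ y (k t (w t))) t := fun y t ht =>
    (hw y t (Ioo_subset_Ico_self ht)).hasDerivAt (Ico_mem_nhds ht.1 ht.2)
  refine ⟨⟨hcont, (hΦ _).symm, fun t => Φ (w t), Eventually.of_forall fun t => hΦ _, ⟨b, ?_⟩, ?_⟩,
    hcont, hwd⟩
  · filter_upwards [ae_restrict_mem measurableSet_Ioo] with t ht
    rw [hΦf]
    exact hb t (Ioo_subset_Ico_self ht)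
  · intro y φ hφ hφc hφs
    obtain ⟨v, rfl⟩ := hΦs y
    have h1 := integral_deriv_smul_eq_neg (hwd v)
      (continuousOn_const.mul ((hkw v).mono Ioo_subset_Ico_self)) hφ hφc hφs
    have h2 : ∫ t in Ioo (0 : ℝ) 1, ((deriv φ t : ℝ) : ℂ) *
        (Complex.I * inner ℂ (Φ v : E) (Φ (w t) : E)) =
        Complex.I * ∫ t in Ioo (0 : ℝ) 1, deriv φ t • inner ℂ (ρ (ρ v)) (w t) := by
      rw [← integral_const_mul]
      refine integral_congr_ae (Eventually.of_forall fun t => ?_)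
      simp only [hΦ, Complex.real_smul, hρ.inner_comm (ρ v)]
      ring
    have h3 : ∫ t in Ioo (0 : ℝ) 1, (φ t : ℂ) * H t (Φ v) (Φ (w t)) =
        Complex.I * ∫ t in Ioo (0 : ℝ) 1, φ t • (-Complex.I * inner ℂ v (k t (w t))) := by
      rw [← integral_const_mul]
      refine setIntegral_congr_fun measurableSet_Ioo fun t ht => ?_
      simp only [Complex.real_smul, hkH t (Ioo_subset_Ico_self ht)]
      linear_combination (φ t : ℂ) * H t (Φ v) (Φ (w t)) * Complex.I_sq
    rw [h2, h3, h1, mul_neg, neg_neg]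

/-- Every solution of the original problem comes from a weak solution of the bounded one. -/
theorem IsSolution.exists_isWeakEvolution (D : IsEvolutionData ρ S k C β)
    (hΦ : ∀ w, (Φ w : E) = ρ w) (hΦs : Function.Surjective Φ)
    (hΦf : ∀ w, A.form (Φ w) = defectForm ρ w)
    (hkH : ∀ t ∈ Ico (0 : ℝ) 1, ∀ w v, inner ℂ w (k t v) = H t (Φ w) (Φ v))
    {x₀ : A.formDomain} {x : ℝ → E} (hx : A.IsSolution H x₀ x) :
    ∃ w : ℝ → E, (∀ t ∈ Ico (0 : ℝ) 1, ρ (w t) = x t) ∧ IsWeakEvolution ρ k w := by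
  obtain ⟨z, hzx, ⟨M, hM⟩, hz⟩ := hx.equation
  choose ζ hζ using fun t => hΦs (z t)
  refine exists_isWeakEvolution_of_distributional D.selfAdjoint_left D.injective_left D.continuous
    D.selfAdjoint (ζ := ζ) (M := √(2 * M)) hx.continuousOn ?_ ?_ fun y φ hφ hφc hφs => ?_
  · filter_upwards [hzx] with t ht
    rw [← hΦ, hζ, ht]
  · filter_upwards [hM] with t ht
    refine Real.le_sqrt_of_sq_le ((D.norm_sq_le_two_mul _).trans ?_)
    rw [← hΦf, hζ]
    linarith
  · have h1 := hz (Φ y) φ hφ hφc hφs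
    simp only [← hζ, hΦ] at h1
    rw [h1]
    refine setIntegral_congr_fun measurableSet_Ioo fun t ht => ?_
    simp only [hkH t (Ioo_subset_Ico_self ht)]

end PosSelfAdjoint

/-! ### Conclusion and choice of the constant -/

theorem mainTheorem5 (C : ℝ) (hC : 0 < C) :
    ∃ K : ℝ → ℝ, (∀ β, 0 < K β) ∧
      ∀ {E : Type*} [NormedAddCommGroup E] [InnerProductSpace ℂ E] [CompleteSpace E]
        (A B : PosSelfAdjoint E)
        (H : ℝ → A.formDomain →ₗ⋆[ℂ] A.formDomain →ₗ[ℂ] ℂ)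
        -- `A ≥ 1`
        (_ : ∀ x : A.op.domain, ‖(x : E)‖ ^ 2 ≤ (inner ℂ (x : E) (A.op x)).re)
        -- the forms `H(t)` are symmetric
        (_ : ∀ t ∈ Ico (0 : ℝ) 1, ∀ x y : A.formDomain, H t x y = conj (H t y x))
        -- `B` commutes with `A`, and its form is defined on `Q(A)`
        (_ : A.StronglyCommute B)
        (hQ : A.formDomain ≤ B.formDomain)
        -- `H(t) ≤ C A`
        (_ : ∀ t ∈ Ico (0 : ℝ) 1, ∀ x : A.formDomain, (H t x x).re ≤ C * A.form x)
        -- `C⁻¹ A - C B ≤ H(t)`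
        (_ : ∀ t ∈ Ico (0 : ℝ) 1, ∀ x : A.formDomain,
          C⁻¹ * A.form x - C * B.form (Submodule.inclusion hQ x) ≤ (H t x x).re)
        -- `i [H(t), B] ≤ C A`
        (_ : ∀ t ∈ Ico (0 : ℝ) 1, ∀ (x : A.formDomain) (hx : (x : E) ∈ B.op.domain)
          (hBx : B.op ⟨x, hx⟩ ∈ A.formDomain),
          (Complex.I * (H t x ⟨B.op ⟨x, hx⟩, hBx⟩ - H t ⟨B.op ⟨x, hx⟩, hBx⟩ x)).re ≤
            C * A.form x)
        -- `H(t)` has a time derivative, and `± Ḣ(t) ≤ C A`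
        (_ : ∀ t ∈ Ico (0 : ℝ) 1, ∀ x : A.formDomain, ∃ d : ℝ,
          HasDerivWithinAt (fun s => (H s x x).re) d (Ico 0 1) t ∧
            -(C * A.form x) ≤ d ∧ d ≤ C * A.form x)
        (x₀ : A.formDomain),
        ∃ x : ℝ → E, A.IsSolution H x₀ x ∧
          (∀ x' : ℝ → E, A.IsSolution H x₀ x' → EqOn x' x (Ico 0 1)) ∧
          ∀ t ∈ Ico (0 : ℝ) 1, ‖x t‖ = ‖(x₀ : E)‖ ∧
            ∃ hx : x t ∈ A.formDomain,
              A.form ⟨x t, hx⟩ ≤ K (A.relFormBound B hQ) *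
                Real.exp (K (A.relFormBound B hQ) * t) *
                  (A.form x₀ + K (A.relFormBound B hQ)) := by
  -- The middle term is the prefactor of the energy estimate and the last its Grönwall rate. The
  -- absolute value keeps the constant positive at every real argument.
  refine ⟨fun β => 1 + C * (C + C * |β|) + (C ^ 2 + C ^ 3), fun β => by positivity, ?_⟩
  intro E _ _ _ A B H hA hsymm hcomm hQ hup hlow hbr hder x₀
  obtain ⟨Φ, ρ, S, k, D, hΦ, hΦs, hΦf, hkH⟩ :=
    PosSelfAdjoint.exists_isEvolutionData hC hA hsymm hcomm hQ hup hlow hbr hder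
  have hρ := D.selfAdjoint_left
  have hβ := D.bound_nonneg
  obtain ⟨w₀, rfl⟩ := hΦs x₀
  obtain ⟨w, rfl, hwb, hw⟩ := D.exists_weak_solution w₀
  have hd0 := D.defectForm_nonneg (w 0)
  obtain ⟨hsol, hev⟩ := PosSelfAdjoint.isSolution_of_weak D hΦ hΦs hΦf hkH
    (b := C * (C + C * A.relFormBound B hQ) * Real.exp (C ^ 2 + C ^ 3) * defectForm ρ (w 0))
    (fun t ht => (hwb t ht).trans (by
      gcongr
      exact mul_le_of_le_one_right (by positivity) ht.2.le)) hw
  refine ⟨fun t => ρ (w t), hsol, fun x' hx' t ht => ?_, fun t ht => ⟨?_, ?_⟩⟩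
  · obtain ⟨w', hw'x, hw'⟩ := hx'.exists_isWeakEvolution D hΦ hΦs hΦf hkH
    have h0 : (0 : ℝ) ∈ Ico (0 : ℝ) 1 := by simp
    rw [← hw'x t ht]
    refine hw'.eq_of_initial hev hρ D.selfAdjoint ?_ ht
    rw [hw'x 0 h0, hx'.initial, hΦ]
  · rw [hΦ]
    exact hev.norm_eq hρ D.selfAdjoint ht
  · have hmem : ρ (w t) ∈ A.formDomain := hΦ (w t) ▸ (Φ (w t)).2
    refine ⟨hmem, ?_⟩
    have h1 : (⟨ρ (w t), hmem⟩ : A.formDomain) = Φ (w t) := Subtype.ext (hΦ _).symm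
    simp only [h1, hΦf, abs_of_nonneg hβ]
    refine (hwb t ht).trans ?_
    have hC' := hC.le
    have ht0 := ht.1
    have h2 : 0 ≤ C * (C + C * A.relFormBound B hQ) := by positivity
    have h3 : 0 ≤ C ^ 2 + C ^ 3 := by positivity
    exact mul_le_mul (mul_le_mul (by linarith)
      (Real.exp_le_exp.mpr (mul_le_mul_of_nonneg_right (by linarith) ht0)) (by positivity)
      (by positivity)) (by linarith) hd0 (by positivity)
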